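/- **Setting.** For $w\in F(a,b)$ let $f_w\in\mathbb Z[x,y,z]$ be the trace polynomial of $w$, i.e. the unique polynomial with $\operatorname{Tr} w(A,B)=f_w(\operatorname{Tr}A,\operatorname{Tr}B,\operatorname{Tr}AB)$ for all $A,B\in \mathrm{SL}(2,\mathbb C)$. For $f\in\mathbb Z[x,y,z]$ let $\operatorname{supp}(f)$ be the set of monomials with nonzero coefficient in $f$, let $[x^iy^jz^k]f$ denote the coefficient of $x^iy^jz^k$, and let $\|f\|_{\mathrm{bit},1}$ be the sum, over the nonzero coefficients of $f$, of the binary lengths of their absolute values. Two models of a random word $W_n$ of length $n$ are considered. In the *positive model* with parameter $p\in(0,1)$, the $n$ letters are independent and equal to $a$ with probability $p$ and to $b$ with probability $1-p$. In the *freely reduced model*, the first letter is uniform on $\{a,a^{-1},b,b^{-1}\}$ and each next letter is uniform among the three letters which are not the inverse of the current one. The words of length $n$ of the model are all positive words, respectively all freely reduced words, of length $n$. Let $U_n$ be uniformly distributed on the cyclically reduced words of length $n$ over $\{a^{\pm1},b^{\pm1}\}$. A *sparse-output convention* is a way of writing polynomials in $\mathbb Z[x,y,z]$ as strings over a fixed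 finite alphabet: the terms with nonzero coefficient are listed, each exactly once and in any order, with a fixed separator string (possibly empty) between consecutive terms. Each term is written as the binary digits of the absolute value of its coefficient, most significant first and each digit $0$, $1$ written as a fixed nonempty block (the two blocks being distinct), preceded and followed by arbitrary strings depending only on the term (for the sign, the exponents and delimiters); and the written string must determine the polynomial. An *algorithm* is a deterministic multitape Turing machine with finitely many states, a finite tape alphabet, and a designated input tape and output tape, which may coincide. On input $w$, the word $w$ stands initially on the input tape from cell $0$ on, all other cells are blank, and all heads are at cell $0$. If the machine halts, its output is the string which stands on the output tape from cell $0$ up to the next blank, where every symbol of the output alphabet is a single tape symbol. In one step the machine rewrites only the scanned cell of each tape and moves each head by at most one cell. Its running time $T_{\mathcal A}(w)$ is the number of steps until it halts. **Theorem.** Fix one of the two random models (and $p\in(0,1)$ in the positive case). 1. There are constants $c,C,\lambda>0$ such that for all $n\ge1$ $$\Pr\bigl(\#\operatorname{supp}(f_{W_n})\ge cn^2\bigr)\ge 1-Ce^{-\lambda n}.$$ 2. There are constants $c_1,c_2,C,\lambda>0$ such that for all $n\ge1$ $$\Pr\bigl(\exists\, i,j,k:\ c_1n^3\le |[x^iy^jz^k]f_{W_n}|\le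 c_2n^3\bigr)\ge 1-Ce^{-\lambda n}.$$ 3. There are constants $c_3,C_3,\lambda_3>0$ such that for all $n\ge1$ $$\Pr\bigl(\|f_{W_n}\|_{\mathrm{bit},1}\ge c_3n^3\bigr)\ge 1-C_3e^{-\lambda_3 n}.$$ 4. For every sparse-output convention there are constants $c_4,C_4,\lambda_4>0$ such that for every algorithm $\mathcal A$ and every $n\ge1$: if $\mathcal A$ computes and outputs $f_w$ in this form on all words $w$ of length $n$ of the model, then $$\Pr\bigl(T_{\mathcal A}(W_n)\ge c_4n^3\bigr)\ge 1-C_4e^{-\lambda_4 n}.$$ Moreover: 5. For every sparse-output convention there are constants $c_5,C_5,\lambda_5>0$ such that for every algorithm $\mathcal A$ and every $n\ge1$: if $\mathcal A$ computes and outputs $f_w$ in this form on all cyclically reduced words $w$ of length $n$, then $$\Pr\bigl(T_{\mathcal A}(U_n)\ge c_5n^3\bigr)\ge 1-C_5e^{-\lambda_5 n}.$$ The constants in 1-3 depend only on the model (including $p$), those in 4 only on the model (including $p$) and the convention, and those in 5 only on the convention. -/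

import Mathlib

/-! ### Words and trace polynomials -/

/-- Letters of `F(a,b)`, in the convention of `FreeGroup (Fin 2)`: the letters `a`, `a⁻¹`, `b`, `b⁻¹`
are `(0, true)`, `(0, false)`, `(1, true)`, `(1, false)`. -/
abbrev Letter : Type := Fin 2 × Bool

/-- Words over `{a, a⁻¹, b, b⁻¹}`. -/
abbrev Word : Type := List Letter

/-- The element of the free group `F(a,b)` which a word represents. -/
def Word.toGroup (w : Word) : FreeGroup (Fin 2) := FreeGroup.mk w

/-- `g(A,B)` for `g ∈ F(a,b)`: substitute `A` for `a` and `B` for `b`. -/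
noncomputable def evalSL (A B : Matrix.SpecialLinearGroup (Fin 2) ℂ) :
    FreeGroup (Fin 2) →* Matrix.SpecialLinearGroup (Fin 2) ℂ :=
  FreeGroup.lift ![A, B]

/-- The trace of an element of `SL(2,ℂ)`. -/
noncomputable def trSL (A : Matrix.SpecialLinearGroup (Fin 2) ℂ) : ℂ :=
  Matrix.trace (A : Matrix (Fin 2) (Fin 2) ℂ)

/-- `f(Tr A, Tr B, Tr(AB))` for `f ∈ ℤ[x,y,z]`; the variables `x, y, z` are `X 0, X 1, X 2`. -/
noncomputable def evalTr (A B : Matrix.SpecialLinearGroup (Fin 2) ℂ)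
    (f : MvPolynomial (Fin 3) ℤ) : ℂ :=
  MvPolynomial.aeval ![trSL A, trSL B, trSL (A * B)] f

/-- `f` is a Fricke trace polynomial of `g`:
`Tr g(A,B) = f(Tr A, Tr B, Tr(AB))` for all `A, B ∈ SL(2,ℂ)`. -/
def IsTracePoly (g : FreeGroup (Fin 2)) (f : MvPolynomial (Fin 3) ℤ) : Prop :=
  ∀ A B : Matrix.SpecialLinearGroup (Fin 2) ℂ, trSL (evalSL A B g) = evalTr A B f

/-- Auxiliary: `g(A,B)` is a combination of `1, A, B, AB` with coefficients in
`ℤ[Tr A, Tr B, Tr(AB)]`, uniformly in `A, B`. -/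
theorem exists_normal_form (g : FreeGroup (Fin 2)) :
    ∃ p q r s : MvPolynomial (Fin 3) ℤ, ∀ A B : Matrix.SpecialLinearGroup (Fin 2) ℂ,
      ((evalSL A B g : Matrix.SpecialLinearGroup (Fin 2) ℂ) : Matrix (Fin 2) (Fin 2) ℂ) =
        evalTr A B p • (1 : Matrix (Fin 2) (Fin 2) ℂ) + evalTr A B q • (A : Matrix (Fin 2) (Fin 2) ℂ)
        + evalTr A B r • (B : Matrix (Fin 2) (Fin 2) ℂ)
        + evalTr A B s • ((A : Matrix (Fin 2) (Fin 2) ℂ) * (B : Matrix (Fin 2) (Fin 2) ℂ)) := by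
  have key : ∀ L : Word, ∃ p q r s : MvPolynomial (Fin 3) ℤ,
      ∀ A B : Matrix.SpecialLinearGroup (Fin 2) ℂ,
      ((evalSL A B (FreeGroup.mk L) : Matrix.SpecialLinearGroup (Fin 2) ℂ) :
          Matrix (Fin 2) (Fin 2) ℂ) =
        evalTr A B p • (1 : Matrix (Fin 2) (Fin 2) ℂ) + evalTr A B q • (A : Matrix (Fin 2) (Fin 2) ℂ)
        + evalTr A B r • (B : Matrix (Fin 2) (Fin 2) ℂ)
        + evalTr A B s • ((A : Matrix (Fin 2) (Fin 2) ℂ) * (B : Matrix (Fin 2) (Fin 2) ℂ)) := by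
    intro L
    induction L with
    | nil =>
      refine ⟨1, 0, 0, 0, fun A B => ?_⟩
      have : (FreeGroup.mk ([] : Word)) = 1 := rfl
      rw [this, map_one]
      simp [evalTr]
    | cons l L ih =>
      obtain ⟨p, q, r, s, h⟩ := ih
      have hmul : ∀ A B : Matrix.SpecialLinearGroup (Fin 2) ℂ,
          evalSL A B (FreeGroup.mk (l :: L)) =
            evalSL A B (FreeGroup.mk [l]) * evalSL A B (FreeGroup.mk L) := by
        intro A B
        rw [← map_mul, FreeGroup.mul_mk]; rfl
      obtain ⟨i, e⟩ := l
      fin_cases i <;> cases e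
      · refine ⟨MvPolynomial.X 0 * p + q, - p, MvPolynomial.X 0 * r + s, - r, fun A B => ?_⟩
        rw [hmul, Matrix.SpecialLinearGroup.coe_mul, h]
        have e1 : evalSL A B (FreeGroup.mk [((0 : Fin 2), false)]) = A⁻¹ := by
          simp [evalSL]
        have dA := A.det_coe
        rw [Matrix.det_fin_two] at dA
        change (evalSL A B (FreeGroup.mk [((0 : Fin 2), false)])).1 * _ = _
        rw [e1]
        ext i j
        fin_cases i <;> fin_cases j <;>
          simp [evalTr, trSL, Matrix.trace_fin_two, Matrix.mul_apply, Fin.sum_univ_two,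
            Matrix.SpecialLinearGroup.coe_inv, Matrix.adjugate_fin_two] <;>
          grind
      · refine ⟨-q, p + MvPolynomial.X 0 * q, -s, r + MvPolynomial.X 0 * s, fun A B => ?_⟩
        rw [hmul, Matrix.SpecialLinearGroup.coe_mul, h]
        have e1 : evalSL A B (FreeGroup.mk [((0 : Fin 2), true)]) = A := by
          simp [evalSL]
        have dA := A.det_coe
        rw [Matrix.det_fin_two] at dA
        change (evalSL A B (FreeGroup.mk [((0 : Fin 2), true)])).1 * _ = _
        rw [e1]
        ext i j
        fin_cases i <;> fin_cases j <;>
          simp [evalTr, trSL, Matrix.trace_fin_two, Matrix.mul_apply, Fin.sum_univ_two] <;>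
          grind
      · refine ⟨MvPolynomial.X 1 * p
            - q * (MvPolynomial.X 2 - MvPolynomial.X 0 * MvPolynomial.X 1) + r
            + MvPolynomial.X 0 * s, - s,
            - p - MvPolynomial.X 0 * q - MvPolynomial.X 2 * s,
            MvPolynomial.X 1 * s + q, fun A B => ?_⟩
        rw [hmul, Matrix.SpecialLinearGroup.coe_mul, h]
        have e1 : evalSL A B (FreeGroup.mk [((1 : Fin 2), false)]) = B⁻¹ := by
          simp [evalSL]
        have dB := B.det_coe
        rw [Matrix.det_fin_two] at dB
        change (evalSL A B (FreeGroup.mk [((1 : Fin 2), false)])).1 * _ = _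
        rw [e1]
        clear h hmul e1
        ext i j
        fin_cases i <;> fin_cases j <;>
          simp [evalTr, trSL, Matrix.trace_fin_two, Matrix.mul_apply, Fin.sum_univ_two,
            Matrix.SpecialLinearGroup.coe_inv, Matrix.adjugate_fin_two] <;>
          grind
      · refine ⟨q * (MvPolynomial.X 2 - MvPolynomial.X 0 * MvPolynomial.X 1) - r
            - MvPolynomial.X 0 * s, MvPolynomial.X 1 * q + s,
            p + MvPolynomial.X 0 * q + MvPolynomial.X 1 * r + MvPolynomial.X 2 * s,
            - q, fun A B => ?_⟩
        rw [hmul, Matrix.SpecialLinearGroup.coe_mul, h]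
        have e1 : evalSL A B (FreeGroup.mk [((1 : Fin 2), true)]) = B := by
          simp [evalSL]
        have dB := B.det_coe
        rw [Matrix.det_fin_two] at dB
        change (evalSL A B (FreeGroup.mk [((1 : Fin 2), true)])).1 * _ = _
        rw [e1]
        clear h hmul e1
        ext i j
        fin_cases i <;> fin_cases j <;>
          simp [evalTr, trSL, Matrix.trace_fin_two, Matrix.mul_apply, Fin.sum_univ_two] <;>
          grind
  obtain ⟨L, rfl⟩ : ∃ L, FreeGroup.mk L = g := ⟨g.toWord, FreeGroup.mk_toWord⟩
  exact key L

/-- Every complex triple is `(Tr A, Tr B, Tr(AB))` for some `A, B ∈ SL(2,ℂ)`. -/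
theorem exists_trace_triple (v : Fin 3 → ℂ) :
    ∃ A B : Matrix.SpecialLinearGroup (Fin 2) ℂ, ![trSL A, trSL B, trSL (A * B)] = v := by
  obtain ⟨r, hr⟩ : ∃ r : ℂ, r * r + v 2 * r + 1 = 0 := by
    obtain ⟨d, hd⟩ := IsAlgClosed.exists_pow_nat_eq (v 2 ^ 2 - 4) (n := 2) (by norm_num)
    refine ⟨(d - v 2) / 2, ?_⟩
    linear_combination hd / 4
  refine ⟨⟨!![v 0, -1; 1, 0], by simp [Matrix.det_fin_two]⟩,
    ⟨!![0, r + v 2; r, v 1], by rw [Matrix.det_fin_two]; simp; linear_combination -hr⟩, ?_⟩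
  funext i
  fin_cases i
  · simp [trSL, Matrix.trace_fin_two]
  · simp [trSL, Matrix.trace_fin_two]
  · change Matrix.trace (!![v 0, -1; 1, 0] * !![0, r + v 2; r, v 1]) = v 2
    simp [Matrix.trace_fin_two]

/-- Existence and uniqueness of the Fricke trace polynomial. -/
theorem existsUnique_tracePoly (g : FreeGroup (Fin 2)) :
    ∃! f : MvPolynomial (Fin 3) ℤ, IsTracePoly g f := by
  obtain ⟨p, q, r, s, h⟩ := exists_normal_form g
  refine ⟨2 * p + MvPolynomial.X 0 * q + MvPolynomial.X 1 * r + MvPolynomial.X 2 * s, ?_, ?_⟩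
  · intro A B
    rw [trSL, h]
    simp [evalTr, trSL, Matrix.trace_add, Matrix.trace_smul]
    ring
  · intro f hf
    generalize hf0 : 2 * p + MvPolynomial.X 0 * q + MvPolynomial.X 1 * r
      + MvPolynomial.X 2 * s = f0
    have hf0' : IsTracePoly g f0 := by
      intro A B
      rw [trSL, h, ← hf0]
      simp [evalTr, trSL, Matrix.trace_add, Matrix.trace_smul]
      ring
    apply MvPolynomial.map_injective (Int.castRingHom ℂ) Int.cast_injective
    apply MvPolynomial.funext
    intro v
    obtain ⟨A, B, rfl⟩ := exists_trace_triple v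
    have e := (hf A B).symm.trans (hf0' A B)
    simp only [evalTr, MvPolynomial.aeval_def, algebraMap_int_eq] at e
    simpa only [MvPolynomial.eval_map] using e

/-- The trace polynomial `f_g ∈ ℤ[x,y,z]` of `g ∈ F(a,b)`: the unique polynomial with
`Tr g(A,B) = f_g(Tr A, Tr B, Tr(AB))` for all `A, B ∈ SL(2,ℂ)`. -/
noncomputable def tracePoly (g : FreeGroup (Fin 2)) : MvPolynomial (Fin 3) ℤ :=
  (existsUnique_tracePoly g).choose

/-- `bit(m)`, the binary length of the absolute value of an integer. -/
def bitLength (m : ℤ) : ℕ := m.natAbs.size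

/-- `‖f‖_{bit,1}`: the sum of the binary lengths of the nonzero coefficients of `f`. -/
noncomputable def bitNorm (f : MvPolynomial (Fin 3) ℤ) : ℕ :=
  ∑ m ∈ f.support, bitLength (f.coeff m)

/-! ### Random words -/

/-- The probability of the event `E` under the discrete law `μ`. -/
noncomputable def PMF.prob {α : Type} (μ : PMF α) (E : α → Prop) : ℝ :=
  (μ.toOuterMeasure {x | E x}).toReal

/-- A random letter which is `a` with probability `p` and `b` with probability `1 - p`. -/
noncomputable def positiveLetter (p : ℝ) (h0 : 0 < p) (h1 : p < 1) : PMF Letter :=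
  (PMF.ofFintype (fun c : Bool => cond c (ENNReal.ofReal p) (ENNReal.ofReal (1 - p))) (by
    simp only [Fintype.sum_bool, cond_true, cond_false]
    rw [← ENNReal.ofReal_add h0.le (by linarith)]; simp)).map
    (fun c => if c then ((0 : Fin 2), true) else ((1 : Fin 2), true))

/-- A random positive word: `n` independent letters, each with law `positiveLetter p`. -/
noncomputable def positiveLaw (p : ℝ) (h0 : 0 < p) (h1 : p < 1) : ℕ → PMF Word
  | 0 => PMF.pure []
  | n + 1 => (positiveLaw p h0 h1 n).bind fun w =>
      (positiveLetter p h0 h1).map fun s => w ++ [s]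

/-- The letters which may follow the word `w` without backtracking: all four if `w` is empty, and
otherwise the three which are not the inverse of the last letter of `w`. -/
def allowedNext (w : Word) : Finset Letter :=
  Finset.univ.filter fun s => ∀ t ∈ w.getLast?, s ≠ (t.1, !t.2)

theorem allowedNext_nonempty (w : Word) : (allowedNext w).Nonempty := by
  unfold allowedNext
  rcases w.getLast? with _ | t
  · exact ⟨(0, true), by simp⟩
  · exact ⟨t, by
      obtain ⟨i, e⟩ := t
      cases e <;> simp⟩

/-- The standard nonbacktracking Markov chain: the first letter is uniform on `{a, a⁻¹, b, b⁻¹}` and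
each next letter is uniform among the three letters which are not the inverse of the current one. -/
noncomputable def nonbacktrackingLaw : ℕ → PMF Word
  | 0 => PMF.pure []
  | n + 1 => (nonbacktrackingLaw n).bind fun w =>
      (PMF.uniformOfFinset (allowedNext w) (allowedNext_nonempty w)).map fun s => w ++ [s]

/-- The two random models: positive words with `Pr(a) = p ∈ (0,1)`, and freely reduced words
generated by the nonbacktracking chain. -/
inductive RandomModel : Type
  | positive (p : ℝ) (h0 : 0 < p) (h1 : p < 1)
  | freelyReduced

/-- The law of the random word `W_n`. -/
noncomputable def RandomModel.law : RandomModel → ℕ → PMF Word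
  | .positive p h0 h1 => positiveLaw p h0 h1
  | .freelyReduced => nonbacktrackingLaw

/-- The words of length `n` of a model: positive words, respectively freely reduced words. -/
def RandomModel.words : RandomModel → ℕ → Set Word
  | .positive _ _ _, n => {w | w.length = n ∧ ∀ s ∈ w, s.2 = true}
  | .freelyReduced, n => {w | w.length = n ∧ FreeGroup.IsReduced w}

/-- The cyclically reduced words of length `n`. -/
def cyclicallyReducedWords (n : ℕ) : Set Word :=
  {w | w.length = n ∧ FreeGroup.IsCyclicallyReduced w}

theorem cyclicallyReducedWords_finite (n : ℕ) : (cyclicallyReducedWords n).Finite :=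
  (List.finite_length_eq Letter n).subset fun _ h => h.1

theorem cyclicallyReducedWords_nonempty (n : ℕ) : (cyclicallyReducedWords n).Nonempty := by
  refine ⟨List.replicate n ((0 : Fin 2), true), by simp, ?_⟩
  rw [FreeGroup.isCyclicallyReduced_iff]
  refine ⟨?_, ?_⟩
  · exact List.isChain_replicate_of_rel n (fun _ => rfl)
  · intro x hx y hy _
    have h1 := List.eq_of_mem_replicate (List.mem_of_mem_getLast? hx)
    have h2 := List.eq_of_mem_replicate (List.mem_of_mem_head? hy)
    rw [h1, h2]

/-- The uniform law on cyclically reduced words of length `n`. -/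
noncomputable def cyclicallyReducedLaw (n : ℕ) : PMF Word :=
  PMF.uniformOfFinset (cyclicallyReducedWords_finite n).toFinset
    ((cyclicallyReducedWords_finite n).toFinset_nonempty.2 (cyclicallyReducedWords_nonempty n))

/-! ### Fully expanded sparse binary form -/

/-- A layout for writing polynomials as lists of terms over a finite alphabet `Sym`. The term with
exponents `m` and coefficient `c ≠ 0` is written as `pre m c`, then the binary digits of `|c|`, most
significant first, with the digit `d` written as the nonempty block `digit d`, then `post m c`.
The blocks `pre` and `post` hold the remaining data (sign, exponents, delimiters).
Consecutive terms are separated by `sep`. -/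
structure SparseLayout where
  Sym : Type
  [finSym : Fintype Sym]
  digit : Bool → List Sym
  digit_ne_nil : ∀ d, digit d ≠ []
  digit_injective : Function.Injective digit
  pre : (Fin 3 →₀ ℕ) → ℤ → List Sym
  post : (Fin 3 →₀ ℕ) → ℤ → List Sym
  sep : List Sym

/-- The string for the term with exponents `m` and coefficient `c`; `Nat.bits` lists the binary
digits with the least significant digit first. -/
def SparseLayout.term (S : SparseLayout) (m : Fin 3 →₀ ℕ) (c : ℤ) : List S.Sym :=
  S.pre m c ++ c.natAbs.bits.reverse.flatMap S.digit ++ S.post m c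

/-- The string `u` is an expanded sparse form of `f`: every monomial with nonzero coefficient is
listed exactly once, in some order, together with its coefficient. -/
def SparseLayout.Represents (S : SparseLayout) (f : MvPolynomial (Fin 3) ℤ) (u : List S.Sym) :
    Prop :=
  ∃ ms : List (Fin 3 →₀ ℕ), ms.Nodup ∧ (∀ m, m ∈ ms ↔ m ∈ f.support) ∧
    u = S.sep.intercalate (ms.map fun m => S.term m (f.coeff m))

/-- A sparse-output convention: a layout in which the written string determines the polynomial. -/
structure SparseConvention extends SparseLayout where
  unambiguous : ∀ f g u, toSparseLayout.Represents f u → toSparseLayout.Represents g u → f = g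

/-! ### Deterministic multitape Turing machines -/

/-- A deterministic Turing machine with `k` two-way infinite tapes, which reads words over
`{a, a⁻¹, b, b⁻¹}` and writes words over `Sym`. In one step it reads the `k` scanned symbols and
either halts (`none`), or changes its state and, on each tape, overwrites the scanned
cell and moves the head by `-1`, `0` or `1`. The input tape and the output tape may coincide. -/
structure TuringMachine (Sym : Type) where
  State : Type
  [finState : Fintype State]
  Symb : Type
  [finSymb : Fintype Symb]
  k : ℕ
  start : State
  blank : Symb
  inTape : Fin k
  outTape : Fin k
  inSymb : Letter → Symb
  inSymb_injective : Function.Injective inSymb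
  inSymb_ne_blank : ∀ s, inSymb s ≠ blank
  outSymb : Sym → Symb
  outSymb_injective : Function.Injective outSymb
  outSymb_ne_blank : ∀ s, outSymb s ≠ blank
  trans : State → (Fin k → Symb) → Option (State × (Fin k → Symb × SignType))

namespace TuringMachine

variable {Sym : Type} (M : TuringMachine Sym)

/-- A configuration: the state, the head positions and the tape contents. -/
structure Config where
  state : M.State
  head : Fin M.k → ℤ
  tape : Fin M.k → ℤ → M.Symb

/-- The initial configuration on input `w`: `w` stands on the cells `0, …, |w| - 1` of the input tape,
all other cells are blank, and all heads are at cell `0`. -/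
def init (w : Word) : M.Config where
  state := M.start
  head := fun _ => 0
  tape := fun i z =>
    if i = M.inTape ∧ 0 ≤ z then (w[z.toNat]?).elim M.blank M.inSymb else M.blank

/-- One step of the computation; `none` if the machine halts in `c`. -/
def step (c : M.Config) : Option M.Config :=
  (M.trans c.state fun i => c.tape i (c.head i)).map fun r =>
    { state := r.1
      head := fun i => c.head i + ((r.2 i).2 : ℤ)
      tape := fun i => Function.update (c.tape i) (c.head i) (r.2 i).1 }

/-- The configuration after `t` steps on input `w`, if the machine makes `t` steps. -/
def run (w : Word) : ℕ → Option M.Config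
  | 0 => some (M.init w)
  | t + 1 => (run w t).bind M.step

/-- On input `w` the machine halts after exactly `t` steps, in the configuration `c`. -/
def HaltsAt (w : Word) (t : ℕ) (c : M.Config) : Prop :=
  M.run w t = some c ∧ M.step c = none

/-- On input `w` the machine halts with output `u`: upon halting, `u` stands on the output tape from
cell `0` on and is followed by a blank. -/
def Outputs (w : Word) (u : List Sym) : Prop :=
  ∃ t c, M.HaltsAt w t c ∧ (∀ i : Fin u.length, c.tape M.outTape (i : ℕ) = M.outSymb (u.get i)) ∧
    c.tape M.outTape (u.length : ℕ) = M.blank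

/-- The running time on input `w`: the number of steps until the machine halts. It is only used for
inputs on which the machine halts (otherwise the value is `0`). -/
noncomputable def time (w : Word) : ℕ := sInf {t | ∃ c, M.HaltsAt w t c}

end TuringMachine

/-- On every input word of `I`, the machine computes and outputs the trace polynomial of the word in
fully expanded sparse binary form. -/
def ComputesTracePoly (S : SparseConvention) (M : TuringMachine S.Sym) (I : Set Word) : Prop :=
  ∀ w ∈ I, ∃ u, M.Outputs w u ∧ S.toSparseLayout.Represents (tracePoly w.toGroup) u

/-! The trace polynomial is invariant under conjugation, and a cyclically reduced word involving
both letters has a rotation which is a product of l syllable pairs a^(±(k+1)) b^(±(j+1)). The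
coefficient of z^l in its trace polynomial is then ± ∏ S_k(x) · ∏ S_j(y), with Chebyshev polynomials
S (`coeff_tracePoly_word`). This is seen by degeneration. Take A, B with traces x, y and Tr AB = u +
1/u, and let u → 0. Since M^(k+1) = S_k(Tr M) M - S_{k-1}(Tr M), the matrix u B^(±(j+1)) tends to
±S_j(y) times the upper right matrix unit, the lower left entry of A^(±(k+1)) is ±S_k(x), and u^l
times the trace of the word tends to the product.

The coefficients of S_k alternate in sign in steps of two, so nothing cancels in these products: up
to sign their coefficients are those of products of `fibPoly`, which lie between those of (1 + t)^K
and (1 + t)^n when K exponents of each letter are at least 3 in absolute value. Hence there is a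
square of monomials with coefficients ±p_i q_j, where C(K,i) ≤ p_i ≤ C(n,i) and likewise for q_j
(`RichTrace`). For K linear in n, the square supplies quadratically many monomials, the indices (3,
0) a coefficient of cubic size, and indices of order n quadratically many coefficients with linearly
many bits each.

It remains to see that K is linear in n outside an exponentially rare event. Occurrences of `aaab`
and `bbba` mark distinct large exponents and are linearly many by a Chernoff bound
(`expRare_patternCount_lt`); the cancellation between the two ends of the word is short
(`expRare_conjugator`). The uniform law on cyclically reduced words is at most four times the
nonbacktracking law, so the estimate passes to it. Finally, a machine changes at most one output
cell per step and starts with at most n nonblank cells, so its time is at least the output length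
minus n, and the output is at least as long as the bit norm. -/

open Polynomial in
/-- The Fibonacci-type polynomials whose coefficients are, up to sign, those of the Chebyshev
polynomials `S`. -/
noncomputable def fibPoly : ℕ → ℕ[X]
  | 0 => 1
  | 1 => 1
  | n + 2 => fibPoly (n + 1) + X * fibPoly n

/-! ### Coefficientwise bounds and sign pattern of Chebyshev polynomials. -/

namespace Polynomial

/-- Coefficientwise comparison of polynomials over `ℕ`. -/
def CoeffLE (P Q : ℕ[X]) : Prop := ∀ j, P.coeff j ≤ Q.coeff j

namespace CoeffLE

theorem refl (P : ℕ[X]) : CoeffLE P P := fun _ => le_rfl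

theorem trans {P Q R : ℕ[X]} (h : CoeffLE P Q) (h' : CoeffLE Q R) : CoeffLE P R :=
  fun j => (h j).trans (h' j)

theorem add {P Q P' Q' : ℕ[X]} (h : CoeffLE P Q) (h' : CoeffLE P' Q') :
    CoeffLE (P + P') (Q + Q') := fun j => by
  simpa only [coeff_add] using Nat.add_le_add (h j) (h' j)

theorem mul {P Q P' Q' : ℕ[X]} (h : CoeffLE P Q) (h' : CoeffLE P' Q') :
    CoeffLE (P * P') (Q * Q') := fun j => by
  simp only [coeff_mul]
  exact Finset.sum_le_sum fun i _ => Nat.mul_le_mul (h _) (h' _)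

theorem self_add (P Q : ℕ[X]) : CoeffLE P (P + Q) := fun j => by
  simp only [coeff_add]; omega

end CoeffLE

/-- The powers of 1 + X satisfy the `fibPoly` recursion with an additional factor 1 + X in the
second term, which only increases coefficients. -/
theorem fibPoly_le_one_add_X_pow (k : ℕ) : CoeffLE (fibPoly k) ((1 + X) ^ k) := by
  induction k using fibPoly.induct with
  | case1 => simpa [fibPoly] using CoeffLE.refl _
  | case2 => simpa [fibPoly] using CoeffLE.self_add 1 X
  | case3 k ih1 ih2 =>
    have e : ((1 + X : ℕ[X])) ^ (k + 2) = (1 + X) ^ (k + 1) + X * ((1 + X) ^ k * (1 + X)) := by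
      ring
    rw [fibPoly, e]
    refine ih1.add ((CoeffLE.refl X).mul (ih2.trans ?_))
    rw [mul_add, mul_one]
    exact CoeffLE.self_add _ _

theorem fibPoly_le_succ (k : ℕ) : CoeffLE (fibPoly k) (fibPoly (k + 1)) := by
  cases k with
  | zero => exact CoeffLE.refl _
  | succ k => exact CoeffLE.self_add _ _

theorem fibPoly_mono {k l : ℕ} (h : k ≤ l) : CoeffLE (fibPoly k) (fibPoly l) := by
  induction h with
  | refl => exact CoeffLE.refl _
  | step _ ih => exact ih.trans (fibPoly_le_succ _)

theorem one_le_fibPoly (k : ℕ) : CoeffLE 1 (fibPoly k) :=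
  fibPoly_mono (k := 0) k.zero_le

theorem one_add_X_le_fibPoly {k : ℕ} (h : 2 ≤ k) : CoeffLE (1 + X) (fibPoly k) := by
  simpa [fibPoly] using fibPoly_mono h

theorem coeff_one_add_X_pow' (n j : ℕ) : ((1 + X : ℕ[X]) ^ n).coeff j = n.choose j := by
  simpa using coeff_one_add_X_pow ℕ n j

/-- `P` has degree at most `d`, and its coefficients at `d, d - 2, d - 4, …` are those of `Q` with
alternating signs, the other coefficients being zero. -/
def AltCoeffs (P : ℤ[X]) (d : ℕ) (Q : ℕ[X]) : Prop :=
  P.natDegree ≤ d ∧ P.reflect d = (Q.map (Nat.castRingHom ℤ)).comp (-X ^ 2)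

namespace AltCoeffs

theorem one : AltCoeffs 1 0 1 := by
  refine ⟨by simp, by simp⟩

/-- Reflection and the substitution of -X² are both multiplicative. This is why products of
Chebyshev polynomials show no cancellation. -/
theorem mul {P P' : ℤ[X]} {d d' : ℕ} {Q Q' : ℕ[X]} (h : AltCoeffs P d Q)
    (h' : AltCoeffs P' d' Q') : AltCoeffs (P * P') (d + d') (Q * Q') := by
  refine ⟨natDegree_mul_le.trans (Nat.add_le_add h.1 h'.1), ?_⟩
  rw [reflect_mul _ _ h.1 h'.1, h.2, h'.2, Polynomial.map_mul, mul_comp]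

theorem coeff {P : ℤ[X]} {d : ℕ} {Q : ℕ[X]} (h : AltCoeffs P d Q) {j : ℕ} (hj : 2 * j ≤ d) :
    P.coeff (d - 2 * j) = (-1) ^ j * (Q.coeff j : ℤ) := by
  have e := congrArg (fun R => Polynomial.coeff R (2 * j)) h.2
  simp only [coeff_reflect, revAt_le hj] at e
  rw [e]
  -- Substituting first -X and then X² separates the sign (-1)^j from the doubling of exponents.
  have e2 : (-X ^ 2 : ℤ[X]) = (-X : ℤ[X]).comp (X ^ 2) := by simp
  rw [e2, ← comp_assoc, ← expand_eq_comp_X_pow, mul_comm 2 j, coeff_expand_mul (by norm_num),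
    show (-X : ℤ[X]) = C (-1) * X by simp, comp_C_mul_X_coeff]
  simp [mul_comm]

theorem chebyshevS (k : ℕ) : AltCoeffs (Chebyshev.S ℤ k) k (fibPoly k) := by
  induction k using fibPoly.induct with
  | case1 => simpa [fibPoly] using one
  | case2 =>
    refine ⟨by simp, ?_⟩
    simp [fibPoly]
  | case3 k ih1 ih2 =>
    have e : Chebyshev.S ℤ ((k + 2 : ℕ) : ℤ)
        = X * Chebyshev.S ℤ ((k + 1 : ℕ) : ℤ) - 1 * Chebyshev.S ℤ (k : ℤ) := by
      push_cast
      rw [Chebyshev.S_add_two, one_mul]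
    -- In degree k + 2 the factor X reflects to 1 and the factor 1, taken in degree 2, to X². So
    -- S_{k+2} = X S_{k+1} - S_k becomes the `fibPoly` recursion at -X².
    have h1 := reflect_mul (X : ℤ[X]) _ (F := 1) (by simp) ih1.1
    have h2 := reflect_mul (1 : ℤ[X]) _ (F := 2) (by simp) ih2.1
    have d1 := natDegree_mul_le (p := (X : ℤ[X])) (q := Chebyshev.S ℤ ((k + 1 : ℕ) : ℤ))
    have d2 := natDegree_mul_le (p := (1 : ℤ[X])) (q := Chebyshev.S ℤ (k : ℤ))
    have d3 := ih1.1
    have d4 := ih2.1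
    rw [natDegree_X] at d1
    rw [natDegree_one] at d2
    refine ⟨?_, ?_⟩
    · rw [e]
      refine (natDegree_sub_le _ _).trans (max_le ?_ ?_) <;> omega
    · change reflect (k + 2) _ = _
      rw [e, reflect_sub, show k + 2 = 1 + (k + 1) by ring, h1, show 1 + (k + 1) = 2 + k by ring,
        h2, ih1.2, ih2.2, show fibPoly k.succ.succ = fibPoly (k + 1) + X * fibPoly k from rfl]
      have r1 : reflect 1 (X : ℤ[X]) = 1 := by simp
      have r2 : reflect 2 (1 : ℤ[X]) = X ^ 2 := by
        simp
      rw [r1, r2]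
      simp
      ring

end AltCoeffs

end Polynomial

/-! ### Powers and traces in SL(2,ℂ). -/

open Polynomial in
/-- `M ^ (k + 1) = S_k(Tr M) M - S_{k-1}(Tr M)` in `SL(2,ℂ)`. -/
theorem specialLinearGroup_pow_succ (M : Matrix.SpecialLinearGroup (Fin 2) ℂ) (k : ℕ) :
    ((M ^ (k + 1) : Matrix.SpecialLinearGroup (Fin 2) ℂ) : Matrix (Fin 2) (Fin 2) ℂ) =
      (Chebyshev.S ℂ k).eval (trSL M) • (M : Matrix (Fin 2) (Fin 2) ℂ) -
        (Chebyshev.S ℂ (k - 1)).eval (trSL M) • (1 : Matrix (Fin 2) (Fin 2) ℂ) := by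
  induction k with
  | zero => simp
  | succ k ih =>
    have hS : Chebyshev.S ℂ ((k : ℤ) + 1) = X * Chebyshev.S ℂ k - Chebyshev.S ℂ (k - 1) :=
      Chebyshev.S_add_one ℂ k
    have hd := M.det_coe
    rw [Matrix.det_fin_two] at hd
    rw [pow_succ, Matrix.SpecialLinearGroup.coe_mul, ih]
    push_cast
    rw [hS, add_sub_cancel_right]
    ext i j
    fin_cases i <;> fin_cases j <;>
      simp [trSL, Matrix.trace_fin_two, Matrix.mul_apply, Fin.sum_univ_two] <;> grind

theorem trSL_inv (M : Matrix.SpecialLinearGroup (Fin 2) ℂ) : trSL M⁻¹ = trSL M := by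
  simp [trSL, Matrix.SpecialLinearGroup.coe_inv, Matrix.adjugate_fin_two, Matrix.trace_fin_two,
    add_comm]

theorem trSL_conj (M N : Matrix.SpecialLinearGroup (Fin 2) ℂ) : trSL (M * N * M⁻¹) = trSL N := by
  have h : (M⁻¹ : Matrix.SpecialLinearGroup (Fin 2) ℂ) * (M * N) = N := by group
  unfold trSL
  rw [Matrix.SpecialLinearGroup.coe_mul, Matrix.trace_mul_comm,
    ← Matrix.SpecialLinearGroup.coe_mul, h]

theorem isTracePoly_tracePoly (g : FreeGroup (Fin 2)) : IsTracePoly g (tracePoly g) :=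
  (existsUnique_tracePoly g).choose_spec.1

/-- This allows passing to the cyclic reduction of a word and to its rotations. -/
theorem tracePoly_conj (g h : FreeGroup (Fin 2)) : tracePoly (g * h * g⁻¹) = tracePoly h := by
  refine (existsUnique_tracePoly h).unique (fun A B => ?_) (isTracePoly_tracePoly h)
  rw [← isTracePoly_tracePoly, map_mul, map_mul, map_inv, trSL_conj]

/-! ### Coefficients from asymptotics, and iterated polynomial rings. -/

namespace Polynomial

open Filter Topology in
/-- If `P(z) / z ^ l → c` along some `z → ∞`, then `c` is the coefficient of `P` at `z ^ l`. -/
theorem coeff_eq_of_tendsto {P : ℂ[X]} {l : ℕ} {c : ℂ} {u : ℕ → ℂ} (hu : ∀ n, u n ≠ 0)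
    (hu0 : Tendsto u atTop (𝓝 0))
    (h : Tendsto (fun n => u n ^ l * P.eval (u n)⁻¹) atTop (𝓝 c)) : P.coeff l = c := by
  -- The reflection of P at u equals u^(l+r) P(1/u) = u^r · u^l P(1/u), and its value at 0 is the
  -- coefficient at l + r.
  have key : ∀ r, P.natDegree ≤ l + r → P.coeff (l + r) = 0 ^ r * c := by
    intro r hr
    have h1 : Tendsto (fun n => (P.reflect (l + r)).eval (u n)) atTop (𝓝 (P.coeff (l + r))) := by
      have := ((P.reflect (l + r)).continuous.tendsto 0).comp hu0
      rw [← coeff_zero_eq_eval_zero, coeff_reflect, revAt_le (Nat.zero_le _), Nat.sub_zero] at this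
      exact this
    refine tendsto_nhds_unique h1 (((hu0.pow r).mul h).congr fun n => ?_)
    have e : (P.reflect (l + r)).eval (u n) * ((u n)⁻¹) ^ (l + r) = P.eval (u n)⁻¹ := by
      let _ := invertibleOfNonzero (inv_ne_zero (hu n))
      have := eval₂_reflect_mul_pow (RingHom.id ℂ) (u n)⁻¹ (l + r) P hr
      simpa [eval₂_eq_eval_map, invOf_eq_inv] using this
    rw [← e, ← mul_assoc, ← pow_add, inv_pow, add_comm r l, mul_comm, mul_assoc,
      inv_mul_cancel₀ (pow_ne_zero _ (hu n)), mul_one]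
  -- If the degree exceeded l, `key` at the degree itself would make the leading coefficient vanish.
  by_cases hd : P.natDegree ≤ l
  · simpa using key 0 hd
  · obtain ⟨r, hr⟩ := Nat.exists_eq_add_of_lt (not_le.1 hd)
    have := key (r + 1) (by omega)
    rw [← add_assoc, ← hr, coeff_natDegree, pow_succ, mul_zero, zero_mul,
      leadingCoeff_eq_zero] at this
    simp [this] at hd

/-- Two bivariate polynomials over `ℂ` with the same values are equal. -/
theorem evalEval_ext {P Q : ℂ[X][X]} (h : ∀ x y, P.evalEval x y = Q.evalEval x y) : P = Q := by
  ext1 j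
  refine Polynomial.funext fun x => ?_
  have : P.map (evalRingHom x) = Q.map (evalRingHom x) := Polynomial.funext fun y => by
    simpa [map_evalRingHom_eval] using h x y
  simpa using congrArg (fun R => Polynomial.coeff R j) this

end Polynomial

open Polynomial in
/-- The embedding `ℤ[x,y,z] → ℂ[x][y][z]`. -/
noncomputable def toTower : MvPolynomial (Fin 3) ℤ →ₐ[ℤ] ℂ[X][X][X] :=
  MvPolynomial.aeval (![C (C X), C X, X] : Fin 3 → ℂ[X][X][X])

/-- The exponent vector of `x ^ i y ^ j z ^ k`. -/
noncomputable def expVec (i j k : ℕ) : Fin 3 →₀ ℕ := Finsupp.equivFunOnFinite.symm ![i, j, k]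

open Polynomial in
theorem coeff_toTower (f : MvPolynomial (Fin 3) ℤ) (i j k : ℕ) :
    (((toTower f).coeff k).coeff j).coeff i = ((f.coeff (expVec i j k) : ℤ) : ℂ) := by
  induction f using MvPolynomial.induction_on' with
  | add p q hp hq => simp [hp, hq]
  | monomial m c =>
    have e : toTower (MvPolynomial.monomial m c)
        = C (C (C (c : ℂ) * X ^ m 0)) * C (X ^ m 1) * X ^ m 2 := by
      simp [toTower, MvPolynomial.aeval_monomial, Finsupp.prod_fintype, Fin.prod_univ_three]
      ring
    have e2 : m = expVec i j k ↔ i = m 0 ∧ j = m 1 ∧ k = m 2 := by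
      constructor
      · rintro rfl; simp [expVec]
      · rintro ⟨rfl, rfl, rfl⟩
        ext t; fin_cases t <;> simp [expVec]
    rw [e, ← C_mul, coeff_C_mul, MvPolynomial.coeff_monomial]
    rw [if_congr e2 rfl rfl, coeff_X_pow]
    by_cases h0 : i = m 0 <;> by_cases h1 : j = m 1 <;> by_cases h2 : k = m 2 <;>
      simp only [h0, h1, h2, coeff_C_mul, coeff_X_pow, if_true, if_false, and_true, and_false,
        mul_one, mul_zero, coeff_zero, Int.cast_zero]

open Polynomial in
theorem eval_map_toTower (f : MvPolynomial (Fin 3) ℤ) (x y z : ℂ) :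
    ((toTower f).map (evalEvalRingHom x y)).eval z = MvPolynomial.aeval ![x, y, z] f := by
  have : ((evalRingHom z).comp ((mapRingHom (evalEvalRingHom x y)).comp toTower.toRingHom))
      = (MvPolynomial.aeval (R := ℤ) ![x, y, z]).toRingHom := by
    refine MvPolynomial.ringHom_ext (fun r => by simp) fun t => ?_
    fin_cases t <;> simp [toTower]
  exact DFunLike.congr_fun this f

/-! ### Syllable pairs and the degenerating family of matrices. -/

/-- A pair of exponents `((σ, k), (τ, j))`, standing for `a ^ (±(k + 1)) b ^ (±(j + 1))`. -/
abbrev SyllablePair : Type := (Bool × ℕ) × (Bool × ℕ)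

/-- The word `a ^ (±(k + 1)) b ^ (±(j + 1))`. -/
def SyllablePair.word (p : SyllablePair) : Word :=
  List.replicate (p.1.2 + 1) (0, p.1.1) ++ List.replicate (p.2.2 + 1) (1, p.2.1)

/-- The sign `±1` attached to the sign of an exponent. -/
def boolSign (σ : Bool) : ℤ := if σ then 1 else -1

theorem boolSign_natAbs (σ : Bool) : (boolSign σ).natAbs = 1 := by cases σ <;> rfl

/-- The product of the Chebyshev polynomials `S` of given indices. -/
noncomputable def chebProd (ks : List ℕ) : Polynomial ℤ :=
  (ks.map fun k : ℕ => Polynomial.Chebyshev.S ℤ (k : ℤ)).prod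

/-- The product of the signs of all exponents. -/
def pairSign (L : List SyllablePair) : ℤ :=
  (L.map fun p => boolSign p.1.1 * boolSign p.2.1).prod

/-- The exponents of `a`, in absolute value and diminished by one. -/
def aExps (L : List SyllablePair) : List ℕ := L.map fun p => p.1.2

/-- The exponents of `b`, in absolute value and diminished by one. -/
def bExps (L : List SyllablePair) : List ℕ := L.map fun p => p.2.2

theorem evalSL_append (A B : Matrix.SpecialLinearGroup (Fin 2) ℂ) (u v : Word) :
    evalSL A B (FreeGroup.mk (u ++ v)) =
      evalSL A B (FreeGroup.mk u) * evalSL A B (FreeGroup.mk v) := by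
  rw [← map_mul, FreeGroup.mul_mk]

theorem evalSL_replicate (A B : Matrix.SpecialLinearGroup (Fin 2) ℂ) (l : Letter) (k : ℕ) :
    evalSL A B (FreeGroup.mk (List.replicate k l)) = evalSL A B (FreeGroup.mk [l]) ^ k := by
  induction k with
  | zero => exact map_one _
  | succ k ih => rw [List.replicate_succ', evalSL_append, ih, pow_succ]

theorem evalSL_letter (A B : Matrix.SpecialLinearGroup (Fin 2) ℂ) (i : Fin 2) (σ : Bool) :
    evalSL A B (FreeGroup.mk [(i, σ)]) = if σ then ![A, B] i else (![A, B] i)⁻¹ := by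
  cases σ <;> simp [evalSL]

/-- The first matrix of the degenerating family. -/
noncomputable def famA (x : ℂ) : Matrix.SpecialLinearGroup (Fin 2) ℂ :=
  ⟨!![x, -1; 1, 0], by simp [Matrix.det_fin_two]⟩

/-- The second matrix of the degenerating family, with parameter `u ≠ 0`; its trace is `y`, and
`Tr (A B) = u + u⁻¹`. -/
noncomputable def famB (y : ℂ) (u : ℂ) (hu : u ≠ 0) : Matrix.SpecialLinearGroup (Fin 2) ℂ :=
  ⟨!![0, u⁻¹; -u, y], by simp [Matrix.det_fin_two, hu]⟩

theorem coe_famB (y u : ℂ) (hu : u ≠ 0) :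
    (famB y u hu : Matrix (Fin 2) (Fin 2) ℂ) = !![0, u⁻¹; -u, y] := rfl

theorem coe_famB_inv (y u : ℂ) (hu : u ≠ 0) :
    ((famB y u hu)⁻¹ : Matrix.SpecialLinearGroup (Fin 2) ℂ).1 = !![y, -u⁻¹; u, 0] := by
  rw [Matrix.SpecialLinearGroup.coe_inv, coe_famB, Matrix.adjugate_fin_two]
  simp

section Degeneration

open Filter Topology Polynomial

theorem eval_chebyshevS_int (k : ℕ) (x : ℂ) :
    (Chebyshev.S ℂ k).eval x = ((Chebyshev.S ℤ k).map (Int.castRingHom ℂ)).eval x := by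
  rw [Chebyshev.map_S]

/-- The value at `x` of an integer polynomial. -/
noncomputable abbrev cval (P : ℤ[X]) (x : ℂ) : ℂ := (P.map (Int.castRingHom ℂ)).eval x

/-- In M^(k+1) = S_k M - S_{k-1} the identity has no lower left entry, and that of A or A⁻¹ is ±1.
-/
theorem famA_power_entry (x y : ℂ) (u : ℂ) (hu : u ≠ 0) (σ : Bool) (k : ℕ) :
    (evalSL (famA x) (famB y u hu) (FreeGroup.mk (List.replicate (k + 1) (0, σ)))).1 1 0
      = boolSign σ * cval (Chebyshev.S ℤ k) x := by
  rw [evalSL_replicate, evalSL_letter]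
  rw [specialLinearGroup_pow_succ, cval, ← eval_chebyshevS_int]
  cases σ
  · simp [trSL_inv, boolSign]
    simp [famA, trSL, Matrix.adjugate_fin_two, Matrix.trace_fin_two]
  · simp [famA, trSL, boolSign, Matrix.trace_fin_two]

/-- Only the upper right entry of B^(±1) is of order u⁻¹, all others stay bounded. The trace y is
independent of u, hence so are the Chebyshev factors. -/
theorem famB_power_tendsto (x y : ℂ) {u : ℕ → ℂ} (hu : ∀ n, u n ≠ 0)
    (hu0 : Tendsto u atTop (𝓝 0)) (τ : Bool) (k : ℕ) :
    Tendsto (fun n => u n • (evalSL (famA x) (famB y (u n) (hu n))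
      (FreeGroup.mk (List.replicate (k + 1) (1, τ)))).1) atTop
      (𝓝 !![0, boolSign τ * cval (Chebyshev.S ℤ k) y; 0, 0]) := by
  have htr : ∀ n, trSL (famB y (u n) (hu n)) = y := fun n => by
    simp [trSL, famB, Matrix.trace_fin_two]
  set c := (Chebyshev.S ℂ k).eval y with hc
  set d := (Chebyshev.S ℂ (k - 1)).eval y with hd
  have e : ∀ n, u n • (evalSL (famA x) (famB y (u n) (hu n))
      (FreeGroup.mk (List.replicate (k + 1) (1, τ)))).1
      = if τ then !![- (u n * d), c; - (c * u n ^ 2), u n * (c * y - d)]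
        else !![u n * (c * y - d), - c; c * u n ^ 2, - (u n * d)] := fun n => by
    rw [evalSL_replicate, evalSL_letter]
    rw [specialLinearGroup_pow_succ]
    have := hu n
    cases τ
    · simp only [Bool.false_eq_true, if_false, Matrix.cons_val_one, Matrix.cons_val_fin_one,
        trSL_inv, htr]
      rw [← hc, ← hd]
      rw [coe_famB_inv]
      ext i j
      fin_cases i <;> fin_cases j <;> simp <;> field_simp
    · simp only [if_true, Matrix.cons_val_one, Matrix.cons_val_fin_one, htr]
      rw [← hc, ← hd]
      rw [coe_famB]
      ext i j
      fin_cases i <;> fin_cases j <;> simp <;> field_simp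
  simp only [e, cval, ← eval_chebyshevS_int, ← hc]
  have h1 : Tendsto (fun n => u n * d) atTop (𝓝 0) := by simpa using hu0.mul_const d
  have h2 : Tendsto (fun n => u n * (c * y - d)) atTop (𝓝 0) := by
    simpa using hu0.mul_const (c * y - d)
  have h3 : Tendsto (fun n => c * u n ^ 2) atTop (𝓝 0) := by
    simpa using (hu0.pow 2).const_mul c
  refine tendsto_pi_nhds.2 fun i => tendsto_pi_nhds.2 fun j => ?_
  cases τ <;> fin_cases i <;> fin_cases j <;>
    simp [boolSign] <;> first
      | exact h1 | exact h2 | exact h3 | exact tendsto_const_nhds | simpa using h1.neg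
      | simpa using h3.neg

/-- The limit for one more pair is the first column of a power of A times the second row of the
previous limit, with a Chebyshev factor. As that row is (0, `N 1 1`), the new first column vanishes
and the lower right entry is multiplied by ±S_k(x) S_j(y). The empty product is the identity, whence
the restriction on `N 0 0`. -/
theorem family_product_tendsto (x y : ℂ) {u : ℕ → ℂ} (hu : ∀ n, u n ≠ 0)
    (hu0 : Tendsto u atTop (𝓝 0)) (L : List SyllablePair) :
    ∃ N : Matrix (Fin 2) (Fin 2) ℂ,
      Tendsto (fun n => u n ^ L.length • (evalSL (famA x) (famB y (u n) (hu n))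
        (FreeGroup.mk (L.flatMap SyllablePair.word))).1) atTop (𝓝 N) ∧
      N 1 0 = 0 ∧ (L ≠ [] → N 0 0 = 0) ∧
      N 1 1 = pairSign L * (cval (chebProd (aExps L)) x * cval (chebProd (bExps L)) y) := by
  induction L with
  | nil =>
    refine ⟨1, ?_, by simp, by simp, by simp [pairSign, chebProd, aExps, bExps, cval]⟩
    have : ∀ n, evalSL (famA x) (famB y (u n) (hu n)) (FreeGroup.mk []) = 1 := fun n => map_one _
    simp [this]
  | cons p L ih =>
    obtain ⟨N, hN, h10, -, h11⟩ := ih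
    obtain ⟨⟨σ, k⟩, ⟨τ, j⟩⟩ := p
    -- A power of the letter a does not involve u, so its value at index 0 represents all of them.
    set Ma : Matrix (Fin 2) (Fin 2) ℂ :=
      (evalSL (famA x) (famB y (u 0) (hu 0)) (FreeGroup.mk (List.replicate (k + 1) (0, σ)))).1
      with hMa
    have hMa' : ∀ n, (evalSL (famA x) (famB y (u n) (hu n))
        (FreeGroup.mk (List.replicate (k + 1) (0, σ)))).1 = Ma := fun n => by
      rw [hMa, evalSL_replicate, evalSL_letter, evalSL_replicate, evalSL_letter]
      simp
    have hB := famB_power_tendsto x y hu hu0 τ j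
    refine ⟨Ma * !![0, boolSign τ * cval (Chebyshev.S ℤ j) y; 0, 0] * N,
      (((tendsto_const_nhds (x := Ma)).mul hB).mul hN).congr fun n => ?_, ?_, ?_, ?_⟩
    · rw [List.flatMap_cons, evalSL_append, SyllablePair.word, evalSL_append]
      rw [Matrix.SpecialLinearGroup.coe_mul, Matrix.SpecialLinearGroup.coe_mul, ← hMa' n,
        List.length_cons, pow_succ]
      simp only [Matrix.mul_smul, Matrix.smul_mul, smul_smul]
    · simp [Matrix.mul_apply, Fin.sum_univ_two, h10]
    · simp [Matrix.mul_apply, Fin.sum_univ_two, h10]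
    · have := famA_power_entry x y (u 0) (hu 0) σ k
      rw [← hMa] at this
      simp [Matrix.mul_apply, Fin.sum_univ_two, h11, this, pairSign, chebProd, aExps, bExps, cval]
      ring

/-- Along the family x and y are fixed while z = Tr AB tends to infinity; the limit of z^(-l) times
the trace is then the coefficient of z^l, by `coeff_eq_of_tendsto`. -/
theorem coeff_tracePoly_word {L : List SyllablePair} (hL : L ≠ []) (i j : ℕ) :
    (tracePoly (Word.toGroup (L.flatMap SyllablePair.word))).coeff (expVec i j L.length) =
      pairSign L * ((chebProd (aExps L)).coeff i * (chebProd (bExps L)).coeff j) := by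
  set g := Word.toGroup (L.flatMap SyllablePair.word) with hg
  set Pa := (chebProd (aExps L)).map (Int.castRingHom ℂ) with hPa
  set Pb := (chebProd (bExps L)).map (Int.castRingHom ℂ) with hPb
  have key : (toTower (tracePoly g)).coeff L.length =
      C (C (pairSign L : ℂ)) * (C Pa * Pb.map C) := by
    refine evalEval_ext fun x y => ?_
    let s : ℕ → ℂ := fun n => 1 / ((n : ℂ) + 1)
    have hs : ∀ n, s n ≠ 0 := fun n => one_div_ne_zero (Nat.cast_add_one_ne_zero n)
    have hs0 : Tendsto s atTop (𝓝 0) := tendsto_one_div_add_atTop_nhds_zero_nat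
    obtain ⟨N, hN, -, h00, h11⟩ := family_product_tendsto x y hs hs0 L
    have htr : Tendsto (fun n => s n ^ L.length *
        trSL (evalSL (famA x) (famB y (s n) (hs n)) g)) atTop
        (𝓝 (pairSign L * (Pa.eval x * Pb.eval y))) := by
      have h := ((Continuous.matrix_trace (continuous_id)).tendsto N).comp hN
      have e : Matrix.trace N = pairSign L * (Pa.eval x * Pb.eval y) := by
        rw [Matrix.trace_fin_two, h00 hL, h11, zero_add]
      rw [id, e] at h
      refine h.congr fun n => ?_
      simp [trSL, Matrix.trace_smul, hg, Word.toGroup]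
    have hs1 : ∀ n, (s n) ^ 2 + 1 ≠ 0 := fun n h => by
      have h' : (((1 / ((n : ℝ) + 1)) ^ 2 + 1 : ℝ) : ℂ) = 0 := by
        push_cast
        simpa [s] using h
      have h2 := Complex.ofReal_eq_zero.1 h'
      have h3 := sq_nonneg (1 / ((n : ℝ) + 1))
      linarith
    -- The family has parameter s, and 1/u = s + 1/s is the trace of AB. As u/s → 1, normalising by
    -- u^l or by s^l gives the same limit.
    let u : ℕ → ℂ := fun n => s n / (s n ^ 2 + 1)
    have hu : ∀ n, u n ≠ 0 := fun n => div_ne_zero (hs n) (hs1 n)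
    have hlim1 : Tendsto (fun n => (s n ^ 2 + 1)⁻¹) atTop (𝓝 1) := by
      have := ((hs0.pow 2).add_const 1).inv₀ (by norm_num)
      simpa using this
    have hu0 : Tendsto u atTop (𝓝 0) := by
      simpa [u, div_eq_mul_inv] using hs0.mul hlim1
    have := coeff_eq_of_tendsto (P := (toTower (tracePoly g)).map (evalEvalRingHom x y))
      (l := L.length) (c := pairSign L * (Pa.eval x * Pb.eval y)) hu hu0 (by
        have h := (hlim1.pow L.length).mul htr
        rw [one_pow, one_mul] at h
        refine h.congr fun n => ?_
        have hA : trSL (famA x) = x := by simp [trSL, famA, Matrix.trace_fin_two]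
        have hB : trSL (famB y (s n) (hs n)) = y := by simp [trSL, famB, Matrix.trace_fin_two]
        have hAB : trSL (famA x * famB y (s n) (hs n)) = (u n)⁻¹ := by
          have := hs n
          rw [trSL, Matrix.SpecialLinearGroup.coe_mul, coe_famB]
          simp [famA, u, Matrix.trace_fin_two]
          field_simp
        rw [isTracePoly_tracePoly g, evalTr, hA, hB, hAB, eval_map_toTower]
        simp only [u, div_eq_mul_inv]
        ring)
    rw [coeff_map, coe_evalEvalRingHom] at this
    rw [this]
    simp [evalEval, eval_map]
  have := congrArg (fun R => (Polynomial.coeff R j).coeff i) key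
  simp only [coeff_toTower] at this
  rw [coeff_C_mul, coeff_C_mul, coeff_C_mul, coeff_map, mul_comm Pa, coeff_C_mul, hPa, hPb,
    coeff_map, coeff_map] at this
  simp only [eq_intCast] at this
  rw [mul_comm ((chebProd (aExps L)).coeff i)]
  exact_mod_cast this

end Degeneration

/-! ### Sizes of the coefficients on one level of z. -/

section RichTrace

open Polynomial

theorem altCoeffs_chebProd (ks : List ℕ) :
    AltCoeffs (chebProd ks) ks.sum (ks.map fibPoly).prod := by
  induction ks with
  | nil => exact AltCoeffs.one
  | cons k ks ih => simpa [chebProd] using (AltCoeffs.chebyshevS k).mul ih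

theorem fibProd_le (ks : List ℕ) : CoeffLE (ks.map fibPoly).prod ((1 + X) ^ ks.sum) := by
  induction ks with
  | nil => simpa using CoeffLE.refl 1
  | cons k ks ih => simpa [pow_add] using (fibPoly_le_one_add_X_pow k).mul ih

/-- The number of entries which are at least `2`. -/
def countLarge (ks : List ℕ) : ℕ := ks.countP fun k => 2 ≤ k

theorem countLarge_cons (k : ℕ) (ks : List ℕ) :
    countLarge (k :: ks) = (if 2 ≤ k then 1 else 0) + countLarge ks := by
  by_cases hk : 2 ≤ k <;> simp [countLarge, hk, add_comm]

/-- Each index at least 2 contributes a factor which dominates 1 + X, every other index one which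
dominates 1. -/
theorem le_fibProd (ks : List ℕ) : CoeffLE ((1 + X) ^ countLarge ks) (ks.map fibPoly).prod := by
  induction ks with
  | nil => simpa [countLarge] using CoeffLE.refl 1
  | cons k ks ih =>
    by_cases hk : 2 ≤ k
    · simpa [countLarge, hk, pow_succ'] using (one_add_X_le_fibPoly hk).mul ih
    · simpa [countLarge, hk] using (one_le_fibPoly k).mul ih

/-- It ensures that the subtractions d - 2i with i ≤ K are not truncated. -/
theorem two_mul_countLarge_le (ks : List ℕ) : 2 * countLarge ks ≤ ks.sum := by
  induction ks with
  | nil => simp [countLarge]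
  | cons k ks ih =>
    unfold countLarge at ih ⊢
    by_cases hk : 2 ≤ k <;> simp [hk] <;> omega

theorem one_add_X_pow_le {m n : ℕ} (h : m ≤ n) : CoeffLE ((1 + X) ^ m) ((1 + X) ^ n) := fun j => by
  rw [coeff_one_add_X_pow', coeff_one_add_X_pow']
  exact Nat.choose_le_choose j h

/-- On some level `z ^ l`, the leading coefficients of `f` in `x` and `y` are, up to sign, those
of a product of polynomials in `x` and in `y` which lie coefficientwise between `(1 + t) ^ K` and
`(1 + t) ^ n`. -/
def RichTrace (f : MvPolynomial (Fin 3) ℤ) (K n : ℕ) : Prop :=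
  ∃ (d e l : ℕ) (P Q : ℕ[X]), 2 * K ≤ d ∧ 2 * K ≤ e ∧
    (∀ i ≤ K, ∀ j ≤ K, (f.coeff (expVec (d - 2 * i) (e - 2 * j) l)).natAbs
      = P.coeff i * Q.coeff j) ∧
    (∀ i, K.choose i ≤ P.coeff i ∧ P.coeff i ≤ n.choose i) ∧
    (∀ i, K.choose i ≤ Q.coeff i ∧ Q.coeff i ≤ n.choose i)

theorem pairSign_natAbs (L : List SyllablePair) : (pairSign L).natAbs = 1 := by
  unfold pairSign
  induction L with
  | nil => rfl
  | cons p L ih => simp [Int.natAbs_mul, boolSign_natAbs, -List.prod_map_mul, ih]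

theorem richTrace_word {L : List SyllablePair} (hL : L ≠ []) {K n : ℕ}
    (ha : K ≤ countLarge (aExps L)) (hb : K ≤ countLarge (bExps L))
    (ha' : (aExps L).sum ≤ n) (hb' : (bExps L).sum ≤ n) :
    RichTrace (tracePoly (Word.toGroup (L.flatMap SyllablePair.word))) K n := by
  have h1 := two_mul_countLarge_le (aExps L)
  have h2 := two_mul_countLarge_le (bExps L)
  have bound : ∀ ks : List ℕ, K ≤ countLarge ks → ks.sum ≤ n → ∀ i,
      K.choose i ≤ (ks.map fibPoly).prod.coeff i ∧ (ks.map fibPoly).prod.coeff i ≤ n.choose i :=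
    fun ks hk hn i => by
      rw [← coeff_one_add_X_pow', ← coeff_one_add_X_pow']
      exact ⟨((one_add_X_pow_le hk).trans (le_fibProd ks)) i,
        ((fibProd_le ks).trans (one_add_X_pow_le hn)) i⟩
  refine ⟨(aExps L).sum, (bExps L).sum, L.length, _, _, by omega, by omega, fun i hi j hj => ?_,
    bound _ ha ha', bound _ hb hb'⟩
  rw [coeff_tracePoly_word hL, (altCoeffs_chebProd _).coeff (by omega),
    (altCoeffs_chebProd _).coeff (by omega)]
  simp [Int.natAbs_mul, pairSign_natAbs, Int.natAbs_pow]

theorem expVec_inj {i j k i' j' k' : ℕ} (h : expVec i j k = expVec i' j' k') :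
    i = i' ∧ j = j' ∧ k = k' := by
  have h0 := DFunLike.congr_fun h 0
  have h1 := DFunLike.congr_fun h 1
  have h2 := DFunLike.congr_fun h 2
  simp [expVec] at h0 h1 h2
  exact ⟨h0, h1, h2⟩

namespace RichTrace

variable {f : MvPolynomial (Fin 3) ℤ} {K n : ℕ}

/-- The index pairs (i, j) with i, j < K give distinct monomials, and both binomial lower bounds are
positive. -/
theorem sq_le_card_support (h : RichTrace f K n) : K ^ 2 ≤ f.support.card := by
  obtain ⟨d, e, l, P, Q, hd, he, hc, hP, hQ⟩ := h
  have := Finset.card_le_card_of_injOn (s := Finset.range K ×ˢ Finset.range K) (t := f.support)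
    (fun t => expVec (d - 2 * t.1) (e - 2 * t.2) l) (fun t ht => by
      simp only [Finset.coe_product, Finset.coe_range, Set.mem_prod, Set.mem_Iio] at ht
      have h1 := hc t.1 ht.1.le t.2 ht.2.le
      have h2 := Nat.choose_pos ht.1.le
      have h3 := Nat.choose_pos ht.2.le
      have h4 := Nat.mul_pos (h2.trans_le (hP t.1).1) (h3.trans_le (hQ t.2).1)
      rw [← h1, Int.natAbs_pos] at h4
      exact MvPolynomial.mem_support_iff.2 h4) (fun t ht t' ht' hh => by
      simp only [Finset.coe_product, Finset.coe_range, Set.mem_prod, Set.mem_Iio] at ht ht'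
      have := expVec_inj hh
      ext <;> omega)
  simpa [sq] using this

/-- Use the indices (3, 0): the two bounds for Q at 0 are both 1, so only the coefficient of P at 3
remains. -/
theorem exists_coeff (h : RichTrace f K n) (hK : 3 ≤ K) :
    ∃ m, K.choose 3 ≤ (f.coeff m).natAbs ∧ (f.coeff m).natAbs ≤ n.choose 3 := by
  obtain ⟨d, e, l, P, Q, hd, he, hc, hP, hQ⟩ := h
  have h0 : Q.coeff 0 = 1 := by
    have := hQ 0
    simp only [Nat.choose_zero_right] at this
    omega
  refine ⟨expVec (d - 2 * 3) (e - 2 * 0) l, ?_⟩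
  rw [hc 3 hK 0 K.zero_le, h0, mul_one]
  exact hP 3

/-- For M < i ≤ 2M one has 2i ≤ K, so C(K,i) ≥ C(2i,i) ≥ 2^i ≥ 2^M. The M² index pairs in this range
thus carry at least M bits each. -/
theorem cube_le_bitNorm (h : RichTrace f K n) {M : ℕ} (hM : 4 * M ≤ K) : M ^ 3 ≤ bitNorm f := by
  obtain ⟨d, e, l, P, Q, hd, he, hc, hP, hQ⟩ := h
  have hcb : ∀ i, 2 ^ i ≤ (2 * i).choose i := by
    intro i
    induction i with
    | zero => simp
    | succ i ih =>
      have h1 := Nat.succ_mul_centralBinom_succ i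
      simp only [Nat.centralBinom] at h1
      have h2 : (i + 1) * 2 ^ (i + 1) ≤ (i + 1) * (2 * (i + 1)).choose (i + 1) := by
        rw [h1, pow_succ]
        nlinarith
      exact Nat.le_of_mul_le_mul_left h2 i.succ_pos
  have hbit : ∀ t ∈ Finset.Ioc M (2 * M) ×ˢ Finset.Ioc M (2 * M),
      M ≤ bitLength (f.coeff (expVec (d - 2 * t.1) (e - 2 * t.2) l)) := by
    rintro ⟨i, j⟩ ht
    simp only [Finset.mem_product, Finset.mem_Ioc] at ht ⊢
    have h1 : 2 ^ M ≤ P.coeff i * Q.coeff j := calc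
      2 ^ M ≤ 2 ^ i := Nat.pow_le_pow_right (by norm_num) ht.1.1.le
      _ ≤ (2 * i).choose i := hcb i
      _ ≤ K.choose i := Nat.choose_le_choose _ (by omega)
      _ ≤ P.coeff i := (hP i).1
      _ ≤ P.coeff i * Q.coeff j :=
        Nat.le_mul_of_pos_right _ ((Nat.choose_pos (by omega)).trans_le (hQ j).1)
    rw [← hc i (by omega) j (by omega)] at h1
    exact (Nat.lt_size.2 h1).le
  have hinj : Set.InjOn (fun t : ℕ × ℕ => expVec (d - 2 * t.1) (e - 2 * t.2) l)
      (Finset.Ioc M (2 * M) ×ˢ Finset.Ioc M (2 * M) : Finset (ℕ × ℕ)) := fun t ht t' ht' hh => by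
    simp only [Finset.coe_product, Finset.coe_Ioc, Set.mem_prod, Set.mem_Ioc] at ht ht'
    have := expVec_inj hh
    ext <;> omega
  unfold bitNorm
  calc M ^ 3 = ∑ t ∈ Finset.Ioc M (2 * M) ×ˢ Finset.Ioc M (2 * M), M := by
        rw [Finset.sum_const, Finset.card_product, Nat.card_Ioc, smul_eq_mul]
        rw [show 2 * M - M = M by omega]
        ring
    _ ≤ ∑ t ∈ Finset.Ioc M (2 * M) ×ˢ Finset.Ioc M (2 * M),
        bitLength (f.coeff (expVec (d - 2 * t.1) (e - 2 * t.2) l)) := Finset.sum_le_sum hbit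
    _ = ∑ m ∈ (Finset.Ioc M (2 * M) ×ˢ Finset.Ioc M (2 * M)).image
        (fun t : ℕ × ℕ => expVec (d - 2 * t.1) (e - 2 * t.2) l), bitLength (f.coeff m) :=
      (Finset.sum_image (f := fun m => bitLength (f.coeff m)) hinj).symm
    _ ≤ ∑ m ∈ f.support, bitLength (f.coeff m) := by
      refine Finset.sum_le_sum_of_ne_zero fun m _ hm => MvPolynomial.mem_support_iff.2 fun h0 => ?_
      simp [h0, bitLength] at hm

end RichTrace

end RichTrace

/-! ### Pattern occurrences and syllables of reduced words. -/

/-- The number of occurrences of the pattern `P` in the word `w`. -/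
def patternCount (P : Word) : Word → ℕ
  | [] => 0
  | l :: w => (if P <+: l :: w then 1 else 0) + patternCount P w

theorem patternCount_le_length (P w : Word) : patternCount P w ≤ w.length := by
  induction w with
  | nil => simp [patternCount]
  | cons l w ih => simp only [patternCount, List.length_cons]; split_ifs <;> omega

theorem patternCount_append_ge (P u v : Word) :
    patternCount P u + patternCount P v ≤ patternCount P (u ++ v) := by
  induction u with
  | nil => simp [patternCount]
  | cons l u ih =>
    simp only [patternCount, List.cons_append]
    by_cases h : P <+: l :: u
    · have : P <+: l :: (u ++ v) := h.trans ⟨v, rfl⟩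
      simp only [h, this, if_true]; omega
    · simp only [h, if_false]; omega

/-- An occurrence of a pattern of length 4 which crosses the junction starts at one of the last
three letters of u. -/
theorem patternCount_append_le {P : Word} (hP : P.length = 4) (u v : Word) :
    patternCount P (u ++ v) ≤ patternCount P u + patternCount P v + min 3 u.length := by
  induction u with
  | nil => simp [patternCount]
  | cons l u ih =>
    simp only [patternCount, List.cons_append, List.length_cons]
    by_cases hu : 3 ≤ u.length
    · have : P <+: l :: (u ++ v) → P <+: l :: u := fun h =>
        List.prefix_of_prefix_length_le h (l₂ := l :: u)
          (by rw [← List.cons_append]; exact List.prefix_append _ _)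
          (by simp only [List.length_cons]; omega)
      by_cases h : P <+: l :: (u ++ v)
      · simp only [h, this h, if_true]; omega
      · simp only [h, if_false]; omega
    · split_ifs <;> omega

/-- The pattern `aaab`. -/
def patA : Word := [(0, true), (0, true), (0, true), (1, true)]

/-- The pattern `bbba`. -/
def patB : Word := [(1, true), (1, true), (1, true), (0, true)]

theorem exists_eq_append_of_patternCount_pos {P w : Word} (h : 0 < patternCount P w) :
    ∃ u v, w = u ++ P ++ v := by
  induction w with
  | nil => simp [patternCount] at h
  | cons l w ih =>
    by_cases hp : P <+: l :: w
    · obtain ⟨v, hv⟩ := hp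
      exact ⟨[], v, by simp [hv]⟩
    · obtain ⟨u, v, rfl⟩ := ih (by simpa [patternCount, hp] using h)
      exact ⟨l :: u, v, by simp⟩

/-- A reduced word which ends in a power of `b` is a product of syllable pairs, possibly preceded by
a power of `b`; occurrences of `aaab` and of `bbba` belong to different exponents `≥ 3`. -/
theorem exists_syllablePairs {w : Word} (hw : FreeGroup.IsReduced w) (hne : w ≠ [])
    (hlast : ∀ s ∈ w.getLast?, s.1 = 1) :
    (∃ L : List SyllablePair, L ≠ [] ∧ w = L.flatMap SyllablePair.word ∧
      patternCount patA w ≤ countLarge (aExps L) ∧ patternCount patB w ≤ countLarge (bExps L)) ∨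
    (∃ (τ : Bool) (j : ℕ) (L : List SyllablePair),
      w = List.replicate (j + 1) (1, τ) ++ L.flatMap SyllablePair.word ∧
      patternCount patA w ≤ countLarge (aExps L) ∧
      patternCount patB w ≤ countLarge (j :: bExps L)) := by
  induction w with
  | nil => exact absurd rfl hne
  | cons l w ih =>
    obtain ⟨i, σ⟩ := l
    rcases w.eq_nil_or_concat with rfl | ⟨w', s, rfl⟩
    · have : i = 1 := hlast (i, σ) (by simp)
      subst this
      exact Or.inr ⟨σ, 0, [], by simp, by simp [patternCount, patA],
        by simp [patternCount, patB]⟩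
    generalize hw0 : w'.concat s = w at *
    have hne' : w ≠ [] := by rw [← hw0]; simp
    have hred : FreeGroup.IsReduced w := hw.infix ⟨[(i, σ)], [], by simp⟩
    have hhead : ∀ s ∈ w.head?, i = s.1 → σ = s.2 := by
      intro s hs
      obtain ⟨w2, rfl⟩ : ∃ w2, w = s :: w2 := by
        cases w with
        | nil => simp at hs
        | cons t w2 => simp at hs; exact ⟨w2, by rw [hs]⟩
      exact (List.isChain_cons_cons.1 hw).1
    have hlast' : ∀ s ∈ w.getLast?, s.1 = 1 := fun s hs => hlast s (by
      rw [List.getLast?_cons_of_ne_nil hne']; exact hs)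
    -- The prepended letter either lengthens the leading syllable or opens a new one; the second
    -- alternative records a leading power of b not yet completed to a pair.
    rcases ih hred hne' hlast' with ⟨L, hL, rfl, h1, h2⟩ | ⟨τ, j, L, rfl, h1, h2⟩
    · obtain ⟨⟨⟨σ', k⟩, ⟨τ, j⟩⟩, L, rfl⟩ := List.exists_cons_of_ne_nil hL
      fin_cases i
      · have : σ = σ' := hhead (0, σ') (by simp [SyllablePair.word, List.replicate_succ]) rfl
        subst this
        -- A new occurrence of `aaab` needs the leading syllable to become exactly a³. Its stored
        -- index then goes from 1 to 2, which is when `countLarge` increases.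
        have hk : patA <+: (0, σ) :: (((σ, k), (τ, j)) :: L).flatMap SyllablePair.word → k = 1 := by
          rcases k with _ | _ | k <;>
            simp [patA, SyllablePair.word, List.replicate_succ, List.cons_prefix_cons]
        refine Or.inl ⟨((σ, k + 1), (τ, j)) :: L, by simp, by
          simp [SyllablePair.word, List.replicate_succ], ?_, ?_⟩
        · simp only [aExps, List.map_cons, countLarge_cons] at h1 ⊢
          simp only [patternCount, Fin.mk_zero]
          split_ifs at h1 ⊢ <;> grind
        · simpa [patternCount, patB, List.cons_prefix_cons, bExps, SyllablePair.word] using h2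
      · refine Or.inr ⟨σ, 0, ((σ', k), (τ, j)) :: L, by simp, ?_, ?_⟩
        · simpa [patternCount, patA, List.cons_prefix_cons] using h1
        · simpa [patternCount, patB, SyllablePair.word, List.replicate_succ,
            List.cons_prefix_cons, countLarge_cons] using h2
    · fin_cases i
      · refine Or.inl ⟨((σ, 0), (τ, j)) :: L, by simp, by
          simp [SyllablePair.word], ?_, ?_⟩
        · simpa [patternCount, patA, List.replicate_succ,
            List.cons_prefix_cons, countLarge_cons, aExps] using h1
        · simpa [patternCount, patB, List.cons_prefix_cons, bExps] using h2
      · have : σ = τ := hhead (1, τ) (by simp [List.replicate_succ]) rfl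
        subst this
        have hj : patB <+: (1, σ) :: (List.replicate (j + 1) (1, σ) ++
            L.flatMap SyllablePair.word) → j = 1 := by
          rcases j with _ | _ | j <;> rcases L with _ | ⟨p, L⟩ <;>
            simp [patB, SyllablePair.word, List.replicate_succ, List.cons_prefix_cons]
        refine Or.inr ⟨σ, j + 1, L, by simp [List.replicate_succ], ?_, ?_⟩
        · simpa [patternCount, patA, List.cons_prefix_cons] using h1
        · simp only [countLarge_cons] at h2 ⊢
          simp only [patternCount, Fin.mk_one]
          split_ifs at h2 ⊢ <;> grind

theorem sum_exps_le (L : List SyllablePair) :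
    (aExps L).sum ≤ (L.flatMap SyllablePair.word).length ∧
      (bExps L).sum ≤ (L.flatMap SyllablePair.word).length := by
  induction L with
  | nil => simp [aExps, bExps]
  | cons p L ih =>
    unfold aExps bExps at ih ⊢
    simp only [List.map_cons, List.sum_cons, List.flatMap_cons, List.length_append,
      SyllablePair.word, List.length_replicate]
    omega

/-- Removing the two conjugating ends costs at most 2r occurrences inside them and 3 at each of two
junctions. The cyclic reduction is then cut inside some `bbba`, between `bbb` and `a`, at a cost of
3 more; the rotation begins with a and ends with b, so it consists of full syllable pairs. -/
theorem richTrace_of_patternCount {w : Word} (hw : FreeGroup.IsReduced w) {r K : ℕ}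
    (hr : (FreeGroup.reduceCyclically.conjugator w).length ≤ r)
    (hA : K + 2 * r + 9 ≤ patternCount patA w) (hB : K + 2 * r + 9 ≤ patternCount patB w) :
    RichTrace (tracePoly w.toGroup) K w.length := by
  set u := FreeGroup.reduceCyclically.conjugator w with hu
  set v := FreeGroup.reduceCyclically w with hv
  have hwe : u ++ v ++ FreeGroup.invRev u = w :=
    FreeGroup.reduceCyclically.conj_conjugator_reduceCyclically w
  have hcyc : FreeGroup.IsCyclicallyReduced v :=
    FreeGroup.reduceCyclically.isCyclicallyReduced hw
  have core : ∀ P : Word, P.length = 4 → patternCount P w ≤ patternCount P v + 2 * r + 6 := by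
    intro P hP
    have h1 := patternCount_append_le hP (u ++ v) (FreeGroup.invRev u)
    have h2 := patternCount_append_le hP u v
    have h3 := patternCount_le_length P u
    have h4 := patternCount_le_length P (FreeGroup.invRev u)
    rw [FreeGroup.invRev_length] at h4
    rw [hwe] at h1
    omega
  have cA := core patA rfl
  have cB := core patB rfl
  obtain ⟨v₁, v₂, hv12⟩ := exists_eq_append_of_patternCount_pos
    (P := patB) (w := v) (by omega)
  set x : Word := (0, true) :: v₂ with hx
  set y : Word := v₁ ++ [(1, true), (1, true), (1, true)] with hy
  have hvxy : v = y ++ x := by rw [hv12, hx, hy]; simp [patB]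
  have rot : ∀ P : Word, P.length = 4 → patternCount P v ≤ patternCount P (x ++ y) + 3 := by
    intro P hP
    have h1 := patternCount_append_le hP y x
    have h2 := patternCount_append_ge P x y
    rw [hvxy]
    omega
  have rA := rot patA rfl
  have rB := rot patB rfl
  -- The new junction joins the last letter of v to its first, where cyclic reducedness applies.
  have hredxy : FreeGroup.IsReduced (x ++ y) := by
    have h1 := hcyc
    rw [hvxy] at h1
    have h2 := List.isChain_append.1 h1.1
    refine List.isChain_append.2 ⟨h2.2.1, h2.1, fun a ha b hb => h1.2 a ?_ b ?_⟩
    · rw [List.getLast?_append_of_ne_nil _ (by simp [hx])]; exact ha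
    · rw [List.head?_append_of_ne_nil _ (by simp [hy])]; exact hb
  have hgrp : tracePoly w.toGroup = tracePoly (Word.toGroup (x ++ y)) := by
    have e1 : w.toGroup = FreeGroup.mk u * FreeGroup.mk v * (FreeGroup.mk u)⁻¹ := by
      rw [FreeGroup.inv_mk, FreeGroup.mul_mk, FreeGroup.mul_mk, hwe]; rfl
    have e2 : FreeGroup.mk v = FreeGroup.mk y * Word.toGroup (x ++ y) * (FreeGroup.mk y)⁻¹ := by
      rw [hvxy, Word.toGroup, ← FreeGroup.mul_mk (L₁ := y), ← FreeGroup.mul_mk (L₁ := x)]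
      group
    rw [e1, tracePoly_conj, e2, tracePoly_conj]
  have hlen : (x ++ y).length ≤ w.length := by
    rw [← hwe, hvxy]; simp only [List.length_append]; omega
  rcases exists_syllablePairs hredxy (by simp [hx]) (fun s hs => by
    rw [hy, ← List.append_assoc, List.getLast?_append_of_ne_nil _ (by simp)] at hs
    simp at hs
    rw [← hs]) with ⟨L, hL, hLe, h1, h2⟩ | ⟨τ, j, L, hLe, -⟩
  · have h3 := sum_exps_le L
    rw [← hLe] at h3
    rw [hgrp, hLe]
    exact richTrace_word hL (by omega) (by omega) (by omega) (by omega)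
  · simp [hx, List.replicate_succ] at hLe

/-! ### Discrete probabilities. -/

namespace PMF

variable {α : Type}

theorem toOuterMeasure_le_one (μ : PMF α) (s : Set α) : μ.toOuterMeasure s ≤ 1 := by
  rw [← (μ.toOuterMeasure_apply_eq_one_iff Set.univ).2 (Set.subset_univ _)]
  exact MeasureTheory.measure_mono (Set.subset_univ s)

theorem toOuterMeasure_ne_top (μ : PMF α) (s : Set α) : μ.toOuterMeasure s ≠ ⊤ :=
  ne_top_of_le_ne_top ENNReal.one_ne_top (μ.toOuterMeasure_le_one s)

theorem prob_mono (μ : PMF α) {E F : α → Prop} (h : ∀ a ∈ μ.support, E a → F a) :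
    μ.prob E ≤ μ.prob F :=
  ENNReal.toReal_mono (μ.toOuterMeasure_ne_top _)
    (μ.toOuterMeasure_mono fun a ha => h a ha.2 ha.1)

theorem prob_or_le (μ : PMF α) (E F : α → Prop) :
    μ.prob (fun a => E a ∨ F a) ≤ μ.prob E + μ.prob F := by
  unfold prob
  rw [← ENNReal.toReal_add (μ.toOuterMeasure_ne_top _) (μ.toOuterMeasure_ne_top _)]
  exact ENNReal.toReal_mono (ENNReal.add_ne_top.2
    ⟨μ.toOuterMeasure_ne_top _, μ.toOuterMeasure_ne_top _⟩) (MeasureTheory.measure_union_le _ _)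

theorem prob_le_one (μ : PMF α) (E : α → Prop) : μ.prob E ≤ 1 :=
  ENNReal.toReal_le_of_le_ofReal zero_le_one (by simpa using μ.toOuterMeasure_le_one _)

theorem one_sub_prob_not_le (μ : PMF α) (E : α → Prop) :
    1 - μ.prob (fun a => ¬ E a) ≤ μ.prob E := by
  have h : μ.prob (fun a => E a ∨ ¬ E a) = 1 := by
    have : μ.toOuterMeasure {a | E a ∨ ¬ E a} = 1 :=
      (μ.toOuterMeasure_apply_eq_one_iff _).2 fun a _ => em (E a)
    rw [prob, this, ENNReal.toReal_one]
  have := μ.prob_or_le E fun a => ¬ E a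
  linarith

open scoped ENNReal in
theorem tsum_bind_mul {β : Type} (μ : PMF α) (f : α → PMF β) (G : β → ℝ≥0∞) :
    ∑' b, (μ.bind f) b * G b = ∑' a, μ a * ∑' b, f a b * G b := by
  simp only [bind_apply, ← ENNReal.tsum_mul_right, ← ENNReal.tsum_mul_left]
  rw [ENNReal.tsum_comm]
  simp only [mul_assoc]

open scoped ENNReal in
theorem tsum_pure_mul (a : α) (G : α → ℝ≥0∞) : ∑' b, (pure a : PMF α) b * G b = G a := by
  rw [tsum_eq_single a fun b hb => by simp [hb]]
  simp

end PMF

/-! ### Markovian words and their transfer operator. -/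

/-- The random word generated letter by letter, with the kernel `K`. -/
noncomputable def markovLaw (K : Word → PMF Letter) : ℕ → PMF Word
  | 0 => PMF.pure []
  | n + 1 => (markovLaw K n).bind fun w => (K w).map fun s => w ++ [s]

theorem positiveLaw_eq (p : ℝ) (h0 : 0 < p) (h1 : p < 1) (n : ℕ) :
    positiveLaw p h0 h1 n = markovLaw (fun _ => positiveLetter p h0 h1) n := by
  induction n with
  | zero => rfl
  | succ n ih => rw [positiveLaw, markovLaw, ih]

/-- The transition kernel of the nonbacktracking chain. -/
noncomputable def nbKernel (w : Word) : PMF Letter :=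
  PMF.uniformOfFinset (allowedNext w) (allowedNext_nonempty w)

theorem nonbacktrackingLaw_eq (n : ℕ) : nonbacktrackingLaw n = markovLaw nbKernel n := by
  induction n with
  | zero => rfl
  | succ n ih => rw [nonbacktrackingLaw, markovLaw, ih]; rfl

/-- The transfer operator of the kernel `K`: the conditional expectation of `g` after one more
letter. -/
noncomputable def transfer (K : Word → PMF Letter) : Module.End ℝ (Word → ℝ) where
  toFun g w := ∑ s, (K w s).toReal * g (w ++ [s])
  map_add' g h := by ext w; simp [mul_add, Finset.sum_add_distrib]
  map_smul' c g := by
    ext w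
    simp only [Pi.smul_apply, smul_eq_mul, RingHom.id_apply, Finset.mul_sum]
    exact Finset.sum_congr rfl fun s _ => by ring

section Transfer

variable (K : Word → PMF Letter)

theorem transfer_apply (g : Word → ℝ) (w : Word) :
    transfer K g w = ∑ s, (K w s).toReal * g (w ++ [s]) := rfl

theorem sum_kernel (w : Word) : ∑ s, (K w s).toReal = 1 := by
  rw [← ENNReal.toReal_sum fun s _ => (K w).apply_ne_top s, ← tsum_fintype (L := .unconditional _), PMF.tsum_coe,
    ENNReal.toReal_one]

theorem transfer_pow_succ (n : ℕ) (g : Word → ℝ) (w : Word) :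
    (transfer K ^ (n + 1)) g w = ∑ s, (K w s).toReal * (transfer K ^ n) g (w ++ [s]) := by
  rw [pow_succ', Module.End.mul_apply, transfer_apply]

theorem transfer_pow_mono {g h : Word → ℝ} (hgh : ∀ w, g w ≤ h w) (n : ℕ) (w : Word) :
    (transfer K ^ n) g w ≤ (transfer K ^ n) h w := by
  induction n generalizing w with
  | zero => exact hgh w
  | succ n ih =>
    rw [transfer_pow_succ, transfer_pow_succ]
    exact Finset.sum_le_sum fun _ _ => mul_le_mul_of_nonneg_left (ih _) ENNReal.toReal_nonneg

theorem sum_kernel_mul_le {w : Word} {g : Letter → ℝ} {c : ℝ} (h : ∀ s, g s ≤ c) :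
    ∑ s, (K w s).toReal * g s ≤ c := calc
  _ ≤ ∑ s, (K w s).toReal * c :=
    Finset.sum_le_sum fun s _ => mul_le_mul_of_nonneg_left (h s) ENNReal.toReal_nonneg
  _ = c := by rw [← Finset.sum_mul, sum_kernel, one_mul]

theorem transfer_pow_le_of_length {g : Word → ℝ} {c : ℝ} (n : ℕ) (w : Word)
    (h : ∀ q : Word, q.length = n → g (w ++ q) ≤ c) : (transfer K ^ n) g w ≤ c := by
  induction n generalizing w with
  | zero => simpa using h [] rfl
  | succ n ih =>
    rw [transfer_pow_succ]
    exact sum_kernel_mul_le K fun s => ih _ fun q hq => by simpa using h (s :: q) (by simp [hq])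

theorem le_transfer_pow {g : Word → ℝ} {c : ℝ} {I : Word → Prop}
    (hI : ∀ w s, I w → K w s ≠ 0 → I (w ++ [s])) (h : ∀ w, I w → c ≤ g w) (n : ℕ) (w : Word)
    (hw : I w) : c ≤ (transfer K ^ n) g w := by
  induction n generalizing w with
  | zero => exact h w hw
  | succ n ih =>
    rw [transfer_pow_succ]
    calc c = ∑ s, (K w s).toReal * c := by rw [← Finset.sum_mul, sum_kernel, one_mul]
      _ ≤ _ := Finset.sum_le_sum fun s _ => by
        by_cases hs : K w s = 0
        · simp [hs]
        · exact mul_le_mul_of_nonneg_left (ih _ (hI w s hw hs)) ENNReal.toReal_nonneg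

/-- Integrating out the last letter replaces g by `transfer K g`, so the induction runs over all
nonnegative g. -/
theorem tsum_markovLaw_mul (n : ℕ) {g : Word → ℝ} (hg : ∀ w, 0 ≤ g w) :
    ∑' w, markovLaw K n w * ENNReal.ofReal (g w) = ENNReal.ofReal ((transfer K ^ n) g []) := by
  induction n generalizing g with
  | zero => rw [markovLaw, PMF.tsum_pure_mul]; rfl
  | succ n ih =>
    have hT : ∀ w, 0 ≤ transfer K g w := fun w => by
      rw [transfer_apply]
      exact Finset.sum_nonneg fun s _ => mul_nonneg ENNReal.toReal_nonneg (hg _)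
    rw [pow_succ, Module.End.mul_apply, ← ih hT, markovLaw, PMF.tsum_bind_mul]
    refine tsum_congr fun w => congrArg _ ?_
    rw [PMF.map, PMF.tsum_bind_mul, tsum_fintype, transfer_apply,
      ENNReal.ofReal_sum_of_nonneg fun s _ => mul_nonneg ENNReal.toReal_nonneg (hg _)]
    refine Finset.sum_congr rfl fun s _ => ?_
    rw [Function.comp_apply, PMF.tsum_pure_mul, ENNReal.ofReal_mul ENNReal.toReal_nonneg,
      ENNReal.ofReal_toReal ((K w).apply_ne_top s)]

/-- The indicator function of an event. -/
noncomputable def eventInd (E : Word → Prop) : Word → ℝ := Set.indicator {w | E w} 1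

theorem eventInd_of {E : Word → Prop} {w : Word} (h : E w) : eventInd E w = 1 :=
  Set.indicator_of_mem (s := {w | E w}) h _

theorem eventInd_of_not {E : Word → Prop} {w : Word} (h : ¬ E w) : eventInd E w = 0 :=
  Set.indicator_of_notMem (s := {w | E w}) h _

theorem eventInd_nonneg (E : Word → Prop) (w : Word) : 0 ≤ eventInd E w :=
  Set.indicator_nonneg (fun _ _ => zero_le_one) w

theorem eventInd_le_one (E : Word → Prop) (w : Word) : eventInd E w ≤ 1 := by
  by_cases h : E w
  · rw [eventInd_of h]
  · rw [eventInd_of_not h]; exact zero_le_one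

theorem prob_markovLaw (n : ℕ) (E : Word → Prop) :
    (markovLaw K n).prob E = (transfer K ^ n) (eventInd E) [] := by
  have h0 : 0 ≤ (transfer K ^ n) (eventInd E) [] := by
    simpa using transfer_pow_mono K (g := 0) (h := eventInd E) (eventInd_nonneg E) n []
  rw [PMF.prob, PMF.toOuterMeasure_apply, ← ENNReal.toReal_ofReal h0,
    ← tsum_markovLaw_mul K n (eventInd_nonneg E)]
  congr 1
  refine tsum_congr fun w => ?_
  by_cases h : E w
  · rw [eventInd_of h, Set.indicator_of_mem (s := {w | E w}) h]; simp
  · rw [eventInd_of_not h, Set.indicator_of_notMem (s := {w | E w}) h]; simp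

theorem markovLaw_support {I : Word → Prop} (h0 : I [])
    (hI : ∀ w s, I w → K w s ≠ 0 → I (w ++ [s])) (n : ℕ) {w : Word}
    (hw : w ∈ (markovLaw K n).support) : w.length = n ∧ I w := by
  induction n generalizing w with
  | zero =>
    rw [markovLaw, PMF.support_pure, Set.mem_singleton_iff] at hw
    simp [hw, h0]
  | succ n ih =>
    rw [markovLaw, PMF.mem_support_bind_iff] at hw
    obtain ⟨v, hv, hw⟩ := hw
    rw [PMF.mem_support_map_iff] at hw
    obtain ⟨s, hs, rfl⟩ := hw
    obtain ⟨h1, h2⟩ := ih hv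
    exact ⟨by simp [h1], hI v s h2 hs⟩

/-- Every letter of `p` has conditional probability at least `δ` when `p` is appended to `w`. -/
def Admissible (δ : ℝ) : Word → Word → Prop
  | _, [] => True
  | w, s :: p => δ ≤ (K w s).toReal ∧ Admissible δ (w ++ [s]) p

theorem transfer_pow_le_self {h : Word → ℝ} (hh : ∀ w s, h (w ++ [s]) ≤ h w) (n : ℕ) (w : Word) :
    (transfer K ^ n) h w ≤ h w := by
  induction n generalizing w with
  | zero => exact le_rfl
  | succ n ih =>
    rw [transfer_pow_succ]
    exact sum_kernel_mul_le K fun s => (ih _).trans (hh w s)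

/-- The continuation p has conditional probability at least δ^|p| and brings h down to B; along any
other, h stays at most H by monotonicity. -/
theorem transfer_pow_le_of_admissible {h : Word → ℝ} (hh : ∀ w s, h (w ++ [s]) ≤ h w)
    {δ : ℝ} (hδ : 0 ≤ δ) {H B : ℝ} (hBH : B ≤ H) (p w : Word) (hp : Admissible K δ w p)
    (hw : h w ≤ H) (hwp : h (w ++ p) ≤ B) :
    (transfer K ^ p.length) h w ≤ H - δ ^ p.length * (H - B) := by
  induction p generalizing w with
  | nil => simpa using hwp
  | cons s p ih =>
    have ih' := ih (w ++ [s]) hp.2 ((hh w s).trans hw) (by simpa using hwp)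
    rw [List.length_cons, transfer_pow_succ]
    set D := δ ^ p.length * (H - B) with hD
    have hD0 : 0 ≤ D := mul_nonneg (pow_nonneg hδ _) (sub_nonneg.2 hBH)
    calc _ ≤ ∑ t, (K w t).toReal * (H - if t = s then D else 0) := by
          refine Finset.sum_le_sum fun t _ =>
            mul_le_mul_of_nonneg_left ?_ ENNReal.toReal_nonneg
          split_ifs with ht
          · rw [ht]; exact ih'
          · rw [sub_zero]
            exact (transfer_pow_le_self K hh _ _).trans ((hh w t).trans hw)
      _ = H - (K w s).toReal * D := by
          simp only [mul_sub, Finset.sum_sub_distrib, ← Finset.sum_mul, sum_kernel, one_mul]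
          simp
      _ ≤ H - δ ^ (p.length + 1) * (H - B) := by
          have := mul_le_mul_of_nonneg_right hp.1 hD0
          rw [pow_succ']
          linarith [mul_assoc δ (δ ^ p.length) (H - B)]

/-- Only the continuation p contributes, and each of its letters has probability at most 1/3. -/
theorem transfer_pow_le_of_forall_ne (hK : ∀ w s, (K w s).toReal ≤ 1 / 3) {g : Word → ℝ}
    (hg : ∀ w, g w ≤ 1) (p w : Word)
    (h : ∀ q : Word, q.length = p.length → q ≠ p → g (w ++ q) = 0) :
    (transfer K ^ p.length) g w ≤ (1 / 3) ^ p.length := by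
  induction p generalizing w with
  | nil => simpa using hg w
  | cons s p ih =>
    rw [List.length_cons, transfer_pow_succ]
    have h0 : ∀ t, t ≠ s → (transfer K ^ p.length) g (w ++ [t]) ≤ 0 := fun t ht =>
      transfer_pow_le_of_length K _ _ fun q hq => by
        have := h (t :: q) (by simp [hq]) (by simp [ht])
        simp [this]
    have h1 := ih (w ++ [s]) fun q hq hqp => by
      simpa using h (s :: q) (by simp [hq]) (by simp [hqp])
    calc _ ≤ ∑ t, if t = s then (1 / 3 : ℝ) * (1 / 3) ^ p.length else 0 := by
          refine Finset.sum_le_sum fun t _ => ?_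
          split_ifs with ht
          · subst ht
            exact (mul_le_mul_of_nonneg_left h1 ENNReal.toReal_nonneg).trans
              (mul_le_mul_of_nonneg_right (hK w t) (by positivity))
          · exact mul_nonpos_of_nonneg_of_nonpos ENNReal.toReal_nonneg (h0 t ht)
      _ = _ := by simp [pow_succ']

end Transfer

/-! ### Exponentially rare events and the Chernoff bound. -/

/-- The events `E n` have exponentially small probability under the laws `μ n`. -/
def ExpRare (μ : ℕ → PMF Word) (E : ℕ → Word → Prop) : Prop :=
  ∃ C lam : ℝ, 0 < C ∧ 0 < lam ∧ ∀ n : ℕ, (μ n).prob (E n) ≤ C * Real.exp (-lam * n)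

namespace ExpRare

variable {μ : ℕ → PMF Word} {E F : ℕ → Word → Prop}

theorem mono (h : ExpRare μ F) (N : ℕ)
    (hEF : ∀ n ≥ N, ∀ w ∈ (μ n).support, E n w → F n w) : ExpRare μ E := by
  obtain ⟨C, lam, hC, hl, hF⟩ := h
  -- The added constant makes the bound at least 1 for all n < N.
  refine ⟨C + Real.exp (lam * N), lam, by positivity, hl, fun n => ?_⟩
  rw [add_mul, ← Real.exp_add]
  by_cases hn : N ≤ n
  · have := (μ n).prob_mono (hEF n hn)
    linarith [hF n, Real.exp_pos (lam * N + -lam * n)]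
  · have h1 : 0 ≤ lam * N + -lam * n := by
      have : (n : ℝ) ≤ N := by exact_mod_cast (not_le.1 hn).le
      nlinarith
    have h2 := Real.one_le_exp h1
    have h3 : 0 < C * Real.exp (-lam * n) := by positivity
    linarith [(μ n).prob_le_one (E n)]

theorem or (hE : ExpRare μ E) (hF : ExpRare μ F) : ExpRare μ fun n w => E n w ∨ F n w := by
  obtain ⟨C, lam, hC, hl, hE⟩ := hE
  obtain ⟨C', lam', hC', hl', hF⟩ := hF
  refine ⟨C + C', min lam lam', by positivity, lt_min hl hl', fun n => ?_⟩
  have h1 : Real.exp (-lam * n) ≤ Real.exp (-(min lam lam') * n) :=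
    Real.exp_le_exp.2 (mul_le_mul_of_nonneg_right (neg_le_neg (min_le_left _ _)) n.cast_nonneg)
  have h2 : Real.exp (-lam' * n) ≤ Real.exp (-(min lam lam') * n) :=
    Real.exp_le_exp.2 (mul_le_mul_of_nonneg_right (neg_le_neg (min_le_right _ _)) n.cast_nonneg)
  have h3 := mul_le_mul_of_nonneg_left h1 hC.le
  have h4 := mul_le_mul_of_nonneg_left h2 hC'.le
  rw [add_mul]
  linarith [(μ n).prob_or_le (E n) (F n), hE n, hF n]

theorem likely (h : ExpRare μ fun n w => ¬ E n w) :
    ∃ C lam : ℝ, 0 < C ∧ 0 < lam ∧ ∀ n : ℕ, 1 - C * Real.exp (-lam * n) ≤ (μ n).prob (E n) := by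
  obtain ⟨C, lam, hC, hl, h⟩ := h
  exact ⟨C, lam, hC, hl, fun n => by linarith [(μ n).one_sub_prob_not_le (E n), h n]⟩

theorem of_prob_le {ν : ℕ → PMF Word} {c : ℝ} (hc : 0 < c) (h : ExpRare μ E)
    (hν : ∀ n, (ν n).prob (E n) ≤ c * (μ n).prob (E n)) : ExpRare ν E := by
  obtain ⟨C, lam, hC, hl, h⟩ := h
  refine ⟨c * C, lam, by positivity, hl, fun n => (hν n).trans ?_⟩
  rw [mul_assoc]
  exact mul_le_mul_of_nonneg_left (h n) hc.le

end ExpRare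

/-- If from every word some admissible continuation of length `m` contains the pattern `P`, then
`P` occurs linearly often, up to exponentially small probability. -/
theorem expRare_patternCount_lt (K : Word → PMF Letter) {P : Word} {m : ℕ} (hm : 0 < m) {δ : ℝ}
    (hδ0 : 0 < δ) (hδ1 : δ ≤ 1)
    (hK : ∀ w, ∃ p : Word, p.length = m ∧ Admissible K δ w p ∧ 1 ≤ patternCount P p) :
    ∃ κ : ℝ, 0 < κ ∧ ExpRare (markovLaw K) fun n w => (patternCount P w : ℝ) < κ * n := by
  -- The expectation of h is an exponential moment of the count. In m further letters h is at least
  -- halved with probability at least δ^m, so its expectation shrinks by the factor ρ below.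
  set h : Word → ℝ := fun w => (1 / 2) ^ patternCount P w with hh
  have hpos : ∀ w, 0 < h w := fun w => by positivity
  have hanti : ∀ u v, h (u ++ v) ≤ h u * (1 / 2) ^ patternCount P v := fun u v => by
    rw [hh, ← pow_add]
    exact pow_le_pow_of_le_one (by norm_num) (by norm_num) (patternCount_append_ge P u v)
  have hmono : ∀ w s, h (w ++ [s]) ≤ h w := fun w s =>
    (hanti w [s]).trans (mul_le_of_le_one_right (hpos w).le
      (pow_le_one₀ (by norm_num) (by norm_num)))
  set ρ : ℝ := 1 - δ ^ m / 2 with hρ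
  have hδm0 : 0 < δ ^ m := by positivity
  have hδm1 : δ ^ m ≤ 1 := pow_le_one₀ hδ0.le hδ1
  have hρ0 : 0 < ρ := by linarith
  have hρ1 : ρ < 1 := by linarith
  have hstep : ∀ w, (transfer K ^ m) h w ≤ (ρ • h) w := fun w => by
    obtain ⟨p, hpm, hp, hc⟩ := hK w
    have h1 : h (w ++ p) ≤ h w / 2 := (hanti w p).trans (by
      have := pow_le_pow_of_le_one (by norm_num : (0 : ℝ) ≤ 1 / 2) (by norm_num) hc
      nlinarith [hpos w])
    have := transfer_pow_le_of_admissible K hmono hδ0.le (H := h w) (B := h w / 2)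
      (by linarith [hpos w]) p w hp le_rfl h1
    rw [hpm] at this
    rw [Pi.smul_apply, smul_eq_mul, hρ]
    linarith
  have hiter : ∀ N w, (transfer K ^ (m * N)) h w ≤ (ρ ^ N • h) w := by
    intro N
    induction N with
    | zero => intro w; simp
    | succ N ih =>
      intro w
      rw [Nat.mul_succ, pow_add, Module.End.mul_apply]
      refine (transfer_pow_mono K hstep _ w).trans ?_
      rw [map_smul, Pi.smul_apply, smul_eq_mul, pow_succ', Pi.smul_apply, smul_eq_mul, mul_assoc]
      exact mul_le_mul_of_nonneg_left (ih w) hρ0.le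
  have htot : ∀ n : ℕ, (transfer K ^ n) h [] ≤ ρ ^ (n / m) := fun n => by
    conv_lhs => rw [← Nat.mod_add_div n m, pow_add, Module.End.mul_apply]
    refine (transfer_pow_mono K (hiter (n / m)) _ []).trans ?_
    rw [map_smul, Pi.smul_apply, smul_eq_mul]
    exact mul_le_of_le_one_right (by positivity)
      ((transfer_pow_le_self K hmono _ []).trans (by simp [hh, patternCount]))
  set L : ℝ := -Real.log ρ with hL
  have hL0 : 0 < L := by have := Real.log_neg hρ0 hρ1; linarith
  have hm' : (0 : ℝ) < m := by exact_mod_cast hm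
  have hlog2 : 0 < Real.log 2 := Real.log_pos (by norm_num)
  -- The expectation of h decays at rate L/m. With this κ, Markov's inequality costs 2^(κn) =
  -- exp(Ln/(2m)), half of that rate; ρ⁻¹ pays for rounding n/m down.
  refine ⟨L / (2 * m * Real.log 2), by positivity, ρ⁻¹, L / (2 * m), by positivity,
    by positivity, fun n => ?_⟩
  set κ := L / (2 * m * Real.log 2) with hκ
  rw [prob_markovLaw]
  have hle : ∀ w, eventInd (fun w => (patternCount P w : ℝ) < κ * n) w
      ≤ (Real.exp (κ * n * Real.log 2) • h) w := fun w => by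
    rw [Pi.smul_apply, smul_eq_mul]
    by_cases hw : (patternCount P w : ℝ) < κ * n
    · rw [eventInd_of hw]
      have e : h w = Real.exp (-(patternCount P w * Real.log 2)) := by
        rw [hh, Real.exp_neg, Real.exp_nat_mul, Real.exp_log (by norm_num)]
        simp
      rw [e, ← Real.exp_add]
      refine Real.one_le_exp ?_
      nlinarith
    · rw [eventInd_of_not hw]
      exact mul_nonneg (Real.exp_pos _).le (hpos w).le
  refine (transfer_pow_mono K hle n []).trans ?_
  rw [map_smul, Pi.smul_apply, smul_eq_mul]
  have h1 : ρ ^ (n / m) ≤ ρ⁻¹ * Real.exp (-(L / m) * n) := by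
    have e : ∀ x : ℕ, ρ ^ x = Real.exp (-L * x) := fun x => by
      rw [hL, neg_neg, mul_comm, Real.exp_nat_mul, Real.exp_log hρ0]
    have e' : ρ⁻¹ = Real.exp L := by rw [hL, Real.exp_neg, Real.exp_log hρ0]
    rw [e, e', ← Real.exp_add]
    refine Real.exp_le_exp.2 ?_
    have h2 : (n : ℝ) < ((n / m : ℕ) + 1) * m := by
      exact_mod_cast (Nat.div_lt_iff_lt_mul hm).1 (Nat.lt_succ_self (n / m))
    have h3 : (n : ℝ) / m ≤ (n / m : ℕ) + 1 := by
      rw [div_le_iff₀ hm']; exact h2.le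
    have h4 : -(L / m) * n = -L * (n / m) := by ring
    rw [h4]
    nlinarith
  calc _ ≤ Real.exp (κ * n * Real.log 2) * (ρ⁻¹ * Real.exp (-(L / m) * n)) :=
        mul_le_mul_of_nonneg_left ((htot n).trans h1) (Real.exp_pos _).le
    _ = ρ⁻¹ * (Real.exp (κ * n * Real.log 2) * Real.exp (-(L / m) * n)) := by ring
    _ = _ := by
        rw [← Real.exp_add]
        congr 2
        rw [hκ]
        field_simp
        ring

/-! ### The two letter kernels, and rich traces of random words. -/

theorem positiveLetter_apply (p : ℝ) (h0 : 0 < p) (h1 : p < 1) :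
    positiveLetter p h0 h1 (0, true) = ENNReal.ofReal p ∧
      positiveLetter p h0 h1 (1, true) = ENNReal.ofReal (1 - p) ∧
      ∀ s : Letter, positiveLetter p h0 h1 s ≠ 0 → s.2 = true := by
  refine ⟨?_, ?_, ?_⟩
  · simp [positiveLetter, Finset.sum_filter]
  · simp [positiveLetter, Finset.sum_filter]
  · rintro ⟨i, _ | _⟩ hs
    · simp [positiveLetter] at hs
    · rfl

theorem mem_allowedNext {w : Word} {s : Letter} :
    s ∈ allowedNext w ↔ ∀ t ∈ w.getLast?, s ≠ (t.1, !t.2) := by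
  simp [allowedNext]

theorem card_allowedNext (w : Word) (hw : w ≠ []) : (allowedNext w).card = 3 := by
  unfold allowedNext
  obtain ⟨t, ht⟩ : ∃ t, w.getLast? = some t := ⟨_, List.getLast?_eq_some_getLast hw⟩
  rw [ht]
  clear ht
  revert t
  decide

theorem card_allowedNext_nil : (allowedNext []).card = 4 := by decide

theorem nbKernel_apply (w : Word) (s : Letter) :
    nbKernel w s = if s ∈ allowedNext w then ((allowedNext w).card : ENNReal)⁻¹ else 0 := by
  rw [nbKernel, PMF.uniformOfFinset_apply]
  congr

theorem nbKernel_toReal_le (w : Word) (s : Letter) : (nbKernel w s).toReal ≤ 1 / 3 := by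
  rw [nbKernel_apply]
  split_ifs
  · by_cases hw : w = []
    · rw [hw, card_allowedNext_nil]; norm_num
    · rw [card_allowedNext w hw]; norm_num
  · norm_num

theorem le_nbKernel_toReal {w : Word} {s : Letter} (hs : s ∈ allowedNext w) :
    1 / 4 ≤ (nbKernel w s).toReal := by
  rw [nbKernel_apply, if_pos hs]
  by_cases hw : w = []
  · rw [hw, card_allowedNext_nil]; norm_num
  · rw [card_allowedNext w hw]; norm_num

theorem isReduced_append_singleton {w : Word} {s : Letter} :
    FreeGroup.IsReduced (w ++ [s]) ↔ FreeGroup.IsReduced w ∧ s ∈ allowedNext w := by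
  rw [FreeGroup.IsReduced, List.isChain_append, mem_allowedNext]
  refine and_congr_right fun _ => ?_
  simp only [List.isChain_singleton, true_and, List.head?_cons, Option.mem_def, Option.some.injEq,
    forall_eq']
  have key : ∀ s t : Letter, (t.1 = s.1 → t.2 = s.2) ↔ s ≠ (t.1, !t.2) := by decide
  exact forall_congr' fun t => imp_congr_right fun _ => key s t

theorem nbKernel_ne_zero {w : Word} {s : Letter} (h : nbKernel w s ≠ 0) : s ∈ allowedNext w := by
  by_contra hs
  rw [nbKernel_apply, if_neg hs] at h
  exact h rfl

theorem isReduced_step (w : Word) (s : Letter) (hw : FreeGroup.IsReduced w)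
    (hs : nbKernel w s ≠ 0) : FreeGroup.IsReduced (w ++ [s]) :=
  isReduced_append_singleton.2 ⟨hw, nbKernel_ne_zero hs⟩

/-- The pattern `xxxy` for the positive letters `x` and `y` of the two given indices. -/
def threeOnePattern (i j : Fin 2) : Word := [(i, true), (i, true), (i, true), (j, true)]

theorem exists_admissible_positive {p : ℝ} (h0 : 0 < p) (h1 : p < 1) (i j : Fin 2) (w : Word) :
    ∃ q : Word, q.length = 4 ∧
      Admissible (fun _ => positiveLetter p h0 h1) (min p (1 - p)) w q ∧
      1 ≤ patternCount (threeOnePattern i j) q := by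
  have key : ∀ i : Fin 2, min p (1 - p) ≤ (positiveLetter p h0 h1 (i, true)).toReal := by
    obtain ⟨ha, hb, -⟩ := positiveLetter_apply p h0 h1
    intro i
    fin_cases i
    · change _ ≤ (positiveLetter p h0 h1 (0, true)).toReal
      rw [ha, ENNReal.toReal_ofReal h0.le]; exact min_le_left _ _
    · change _ ≤ (positiveLetter p h0 h1 (1, true)).toReal
      rw [hb, ENNReal.toReal_ofReal (by linarith)]; exact min_le_right _ _
  exact ⟨threeOnePattern i j, rfl, ⟨key i, key i, key i, key j, trivial⟩,
    by simp [threeOnePattern, patternCount]⟩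

/-- If the letter x of index i may not follow w, then w ends in x⁻¹ and the other letter y may. A
spare y behind or in front of `xxxy` gives both cases length 5. -/
theorem exists_admissible_nb {i j : Fin 2} (hij : i ≠ j) (w : Word) :
    ∃ q : Word, q.length = 5 ∧ Admissible nbKernel (1 / 4) w q ∧
      1 ≤ patternCount (threeOnePattern i j) q := by
  have step : ∀ (v : Word) (k l : Fin 2), 1 / 4 ≤ (nbKernel (v ++ [(k, true)]) (l, true)).toReal :=
    fun v k l => le_nbKernel_toReal (mem_allowedNext.2 (by simp))
  by_cases h : ((i, true) : Letter) ∈ allowedNext w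
  · exact ⟨threeOnePattern i j ++ [(j, true)], rfl,
      ⟨le_nbKernel_toReal h, step _ _ _, step _ _ _, step _ _ _, step _ _ _, trivial⟩,
      by simp [threeOnePattern, patternCount, List.cons_prefix_cons]⟩
  · have h' : ((j, true) : Letter) ∈ allowedNext w := by
      simp only [mem_allowedNext, Option.mem_def, not_forall, not_not] at h ⊢
      obtain ⟨t, ht, he⟩ := h
      intro t' ht' he'
      rw [ht, Option.some.injEq] at ht'
      subst ht'
      rw [← he] at he'
      exact hij (congrArg Prod.fst he').symm
    exact ⟨(j, true) :: threeOnePattern i j, rfl,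
      ⟨le_nbKernel_toReal h', step _ _ _, step _ _ _, step _ _ _, step _ _ _, trivial⟩,
      by simp [threeOnePattern, patternCount, List.cons_prefix_cons]⟩

theorem conjugator_eq_nil {w : Word} (hw : FreeGroup.IsCyclicallyReduced w) :
    FreeGroup.reduceCyclically.conjugator w = [] := by
  induction w using List.bidirectionalRec with
  | nil => simp
  | singleton => simp
  | cons_append a l b ih =>
    rw [FreeGroup.reduceCyclically.conjugator.cons_append, if_neg]
    rintro ⟨h1, h2⟩
    have := (FreeGroup.isCyclicallyReduced_cons_append_iff.1 hw).2 h1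
    simp [this] at h2

theorem isCyclicallyReduced_of_positive {w : Word} (hw : ∀ s ∈ w, s.2 = true) :
    FreeGroup.IsCyclicallyReduced w := by
  refine ⟨List.Pairwise.isChain (List.pairwise_iff_forall_sublist.2 fun {a b} h _ => ?_),
    fun a ha b hb _ => ?_⟩
  · rw [hw a (h.subset (by simp)), hw b (h.subset (by simp))]
  · rw [hw a (List.mem_of_mem_getLast? ha), hw b (List.mem_of_mem_head? hb)]

/-- Long cancellation between the two ends of the nonbacktracking word is rare. -/
theorem expRare_conjugator {ε : ℝ} (hε : 0 < ε) :
    ExpRare (markovLaw nbKernel) fun n w =>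
      ε * n ≤ ((FreeGroup.reduceCyclically.conjugator w).length : ℝ) := by
  refine ⟨1, ε, one_pos, hε, fun n => ?_⟩
  set r := ⌈ε * n⌉₊ with hr
  set E : Word → Prop := fun w => ε * n ≤ ((FreeGroup.reduceCyclically.conjugator w).length : ℝ)
  have hE : ∀ w, E w → r ≤ (FreeGroup.reduceCyclically.conjugator w).length := fun w hw =>
    Nat.ceil_le.2 hw
  have hsplit : ∀ w : Word, FreeGroup.reduceCyclically.conjugator w ++
      FreeGroup.reduceCyclically w ++
      FreeGroup.invRev (FreeGroup.reduceCyclically.conjugator w) = w :=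
    FreeGroup.reduceCyclically.conj_conjugator_reduceCyclically
  rw [prob_markovLaw, one_mul]
  by_cases hrn : 2 * r ≤ n
  · have h1 : (transfer nbKernel ^ n) (eventInd E) [] ≤ (1 / 3) ^ r := by
      conv_lhs => rw [← Nat.sub_add_cancel (show r ≤ n by omega), pow_add, Module.End.mul_apply]
      refine transfer_pow_le_of_length _ _ _ fun w hw => ?_
      rw [List.nil_append]
      set p := FreeGroup.invRev (w.take r) with hp
      have hpl : p.length = r := by
        rw [hp, FreeGroup.invRev_length, List.length_take]; omega
      rw [← hpl]
      refine transfer_pow_le_of_forall_ne nbKernel nbKernel_toReal_le (eventInd_le_one E) p w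
        fun q hq hqp => eventInd_of_not fun hwq => hqp ?_
      have h2 := hE _ hwq
      set u := FreeGroup.reduceCyclically.conjugator (w ++ q) with hu
      have h3 := hsplit (w ++ q)
      rw [← hu] at h3
      have h4 : u.take r = w.take r := by
        have := congrArg (List.take r) h3
        rw [List.append_assoc, List.take_append_of_le_length h2,
          List.take_append_of_le_length (by omega)] at this
        exact this
      have h5 : FreeGroup.invRev u =
          FreeGroup.invRev (u.drop r) ++ FreeGroup.invRev (u.take r) := by
        rw [← FreeGroup.invRev_append, List.take_append_drop]
      rw [h5, h4, ← hp, ← List.append_assoc] at h3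
      exact (List.append_inj_right' h3 (by rw [hpl, hq, hpl])).symm
    refine h1.trans ?_
    have h6 : (1 / 3 : ℝ) ≤ Real.exp (-1) := by
      rw [Real.exp_neg, one_div]
      exact inv_anti₀ (Real.exp_pos 1) (by linarith [Real.exp_one_lt_d9])
    calc (1 / 3 : ℝ) ^ r ≤ Real.exp (-1) ^ r := pow_le_pow_left₀ (by norm_num) h6 r
      _ = Real.exp (r * (-1)) := (Real.exp_nat_mul _ _).symm
      _ ≤ _ := Real.exp_le_exp.2 (by linarith [Nat.le_ceil (ε * n)])
  -- The conjugator fills at most half of the word, so here the event is impossible.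
  · refine (transfer_pow_le_of_length nbKernel (c := 0) n [] fun w hw => ?_).trans
      (Real.exp_pos _).le
    rw [List.nil_append, eventInd_of_not]
    intro h
    have h1 := hE w h
    have h2 := congrArg List.length (hsplit w)
    simp only [List.length_append, FreeGroup.invRev_length] at h2
    omega

theorem expRare_not_richTrace {μ : ℕ → PMF Word}
    (hμ : ∀ n, ∀ w ∈ (μ n).support, w.length = n ∧ FreeGroup.IsReduced w)
    (hA : ∃ κ : ℝ, 0 < κ ∧ ExpRare μ fun n w => (patternCount patA w : ℝ) < κ * n)
    (hB : ∃ κ : ℝ, 0 < κ ∧ ExpRare μ fun n w => (patternCount patB w : ℝ) < κ * n)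
    (hC : ∀ ε : ℝ, 0 < ε → ExpRare μ fun n w =>
      ε * n ≤ ((FreeGroup.reduceCyclically.conjugator w).length : ℝ)) :
    ∃ κ : ℝ, 0 < κ ∧ ExpRare μ fun n w => ¬ RichTrace (tracePoly w.toGroup) ⌊κ * n⌋₊ n := by
  obtain ⟨κ₁, h₁, hA⟩ := hA
  obtain ⟨κ₂, h₂, hB⟩ := hB
  -- With K = r = ⌊κn⌋ the required count K + 2r + 9 is at most 3κn + 9, hence at most 4κn as soon
  -- as κn ≥ 9.
  set κ := min κ₁ κ₂ / 4 with hκ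
  have hκ0 : 0 < κ := by have := lt_min h₁ h₂; positivity
  refine ⟨κ, hκ0, ((hA.or hB).or (hC κ hκ0)).mono ⌈9 / κ⌉₊ fun n hn w hw hrich => ?_⟩
  by_contra hcon
  simp only [not_or, not_lt, not_le] at hcon
  obtain ⟨⟨h3, h4⟩, h5⟩ := hcon
  obtain ⟨h6, h7⟩ := hμ n w hw
  have hn0 : (0 : ℝ) ≤ n := n.cast_nonneg
  have h8 : 9 ≤ κ * n := by
    have := (Nat.le_ceil (9 / κ)).trans (Nat.cast_le.2 hn)
    rwa [div_le_iff₀ hκ0, mul_comm] at this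
  have h9 : (⌊κ * n⌋₊ : ℝ) ≤ κ * n := Nat.floor_le (by positivity)
  have h10 : (FreeGroup.reduceCyclically.conjugator w).length ≤ ⌊κ * n⌋₊ :=
    Nat.le_floor h5.le
  have h11 : 4 * κ * n ≤ κ₁ * n := mul_le_mul_of_nonneg_right
    (by rw [hκ]; linarith [min_le_left κ₁ κ₂]) hn0
  have h12 : 4 * κ * n ≤ κ₂ * n := mul_le_mul_of_nonneg_right
    (by rw [hκ]; linarith [min_le_right κ₁ κ₂]) hn0
  have := richTrace_of_patternCount h7 (K := ⌊κ * n⌋₊) h10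
    (by have : ((⌊κ * n⌋₊ + 2 * ⌊κ * n⌋₊ + 9 : ℕ) : ℝ) ≤ patternCount patA w := by
          push_cast; linarith
        exact_mod_cast this)
    (by have : ((⌊κ * n⌋₊ + 2 * ⌊κ * n⌋₊ + 9 : ℕ) : ℝ) ≤ patternCount patB w := by
          push_cast; linarith
        exact_mod_cast this)
  rw [h6] at this
  exact hrich this

theorem ExpRare.conjugator_of_isCyclicallyReduced {μ : ℕ → PMF Word}
    (hμ : ∀ n, ∀ w ∈ (μ n).support, FreeGroup.IsCyclicallyReduced w) {ε : ℝ} (hε : 0 < ε) :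
    ExpRare μ fun n w => ε * n ≤ ((FreeGroup.reduceCyclically.conjugator w).length : ℝ) := by
  have h : ExpRare μ fun _ _ => False := ⟨1, 1, one_pos, one_pos, fun n => by
    have : (μ n).prob (fun _ => False) = 0 := by simp [PMF.prob]
    rw [this]; positivity⟩
  -- At n = 0 the event reads 0 ≤ 0 and holds, so it is impossible only from n = 1 on.
  refine h.mono 1 fun n hn w hw hle => ?_
  rw [conjugator_eq_nil (hμ n w hw), List.length_nil, Nat.cast_zero] at hle
  have : (0 : ℝ) < n := by exact_mod_cast hn
  nlinarith

namespace RandomModel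

theorem law_support (M : RandomModel) (n : ℕ) {w : Word} (hw : w ∈ (M.law n).support) :
    w ∈ M.words n := by
  cases M with
  | positive p h0 h1 =>
    rw [law, positiveLaw_eq] at hw
    refine markovLaw_support _ (I := fun w => ∀ s ∈ w, s.2 = true) (by simp) ?_ n hw
    intro w s hw hs t ht
    rcases List.mem_append.1 ht with ht | ht
    · exact hw t ht
    · rw [List.mem_singleton.1 ht]
      exact (positiveLetter_apply p h0 h1).2.2 s hs
  | freelyReduced =>
    rw [law, nonbacktrackingLaw_eq] at hw
    exact markovLaw_support _ (I := FreeGroup.IsReduced) (by simp [FreeGroup.IsReduced])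
      isReduced_step n hw

theorem words_reduced (M : RandomModel) (n : ℕ) {w : Word} (hw : w ∈ M.words n) :
    w.length = n ∧ FreeGroup.IsReduced w := by
  cases M with
  | positive p h0 h1 => exact ⟨hw.1, (isCyclicallyReduced_of_positive hw.2).1⟩
  | freelyReduced => exact hw

theorem expRare_patternCount (M : RandomModel) {i j : Fin 2} (hij : i ≠ j) :
    ∃ κ : ℝ, 0 < κ ∧
      ExpRare M.law fun n w => (patternCount (threeOnePattern i j) w : ℝ) < κ * n := by
  cases M with
  | positive p h0 h1 =>
    rw [law, funext (positiveLaw_eq p h0 h1)]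
    exact expRare_patternCount_lt _ (by norm_num) (lt_min h0 (by linarith))
      ((min_le_left _ _).trans h1.le) (exists_admissible_positive h0 h1 i j)
  | freelyReduced =>
    rw [law, funext nonbacktrackingLaw_eq]
    exact expRare_patternCount_lt _ (by norm_num) (by norm_num) (by norm_num)
      (exists_admissible_nb hij)

theorem expRare_conjugator (M : RandomModel) {ε : ℝ} (hε : 0 < ε) :
    ExpRare M.law fun n w =>
      ε * n ≤ ((FreeGroup.reduceCyclically.conjugator w).length : ℝ) := by
  cases M with
  | positive p h0 h1 =>
    exact ExpRare.conjugator_of_isCyclicallyReduced (fun n w hw =>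
      isCyclicallyReduced_of_positive ((positive p h0 h1).law_support n hw).2) hε
  | freelyReduced =>
    rw [law, funext nonbacktrackingLaw_eq]
    exact _root_.expRare_conjugator hε

theorem expRare_not_richTrace (M : RandomModel) :
    ∃ κ : ℝ, 0 < κ ∧
      ExpRare M.law fun n w => ¬ RichTrace (tracePoly w.toGroup) ⌊κ * n⌋₊ n :=
  _root_.expRare_not_richTrace (fun n _ hw => M.words_reduced n (M.law_support n hw))
    (M.expRare_patternCount (i := 0) (j := 1) (by decide))
    (M.expRare_patternCount (i := 1) (j := 0) (by decide)) fun _ hε => M.expRare_conjugator hε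

end RandomModel

/-! ### Comparison with the uniform law on cyclically reduced words. -/

section Cyclic

theorem markovLaw_append (K : Word → PMF Letter) (n : ℕ) (w : Word) (s : Letter) :
    markovLaw K (n + 1) (w ++ [s]) = markovLaw K n w * K w s := by
  rw [markovLaw, PMF.bind_apply, tsum_eq_single w]
  · rw [PMF.map_apply, tsum_eq_single s]
    · simp
    · intro t ht
      rw [if_neg]
      simpa using ht.symm
  · intro v hv
    rw [PMF.map_apply, ENNReal.tsum_eq_zero.2, mul_zero]
    intro t
    rw [if_neg]
    intro h
    exact hv (List.append_inj_left' h rfl).symm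

/-- The number of allowed letters, 4 at the start and 3 later, depends only on the position. -/
theorem markovLaw_nbKernel_eq (n : ℕ) : ∃ c : ENNReal, ∀ w : Word, w.length = n →
    FreeGroup.IsReduced w → markovLaw nbKernel n w = c := by
  induction n with
  | zero =>
    exact ⟨_, fun w hw _ => congrArg _ (List.length_eq_zero_iff.1 hw)⟩
  | succ n ih =>
    obtain ⟨c, hc⟩ := ih
    refine ⟨c * (if n = 0 then 4 else 3 : ENNReal)⁻¹, fun w hw hred => ?_⟩
    rcases w.eq_nil_or_concat with rfl | ⟨v, s, rfl⟩
    · simp at hw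
    · rw [List.concat_eq_append] at hw hred ⊢
      have hv : v.length = n := by simpa using hw
      obtain ⟨h1, h2⟩ := isReduced_append_singleton.1 hred
      rw [markovLaw_append, hc v hv h1, nbKernel_apply, if_pos h2]
      by_cases h0 : n = 0
      · rw [if_pos h0, List.length_eq_zero_iff.1 (hv.trans h0), card_allowedNext_nil]; norm_num
      · rw [if_neg h0, card_allowedNext v (by rintro rfl; exact h0 hv.symm)]; norm_num

/-- Whatever the earlier letters, some last letter is inverse neither to its predecessor nor to the
first letter, and its probability is at least 1/4. -/
theorem quarter_le_prob_isCyclicallyReduced (n : ℕ) :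
    1 / 4 ≤ (markovLaw nbKernel n).prob FreeGroup.IsCyclicallyReduced := by
  rw [prob_markovLaw]
  cases n with
  | zero =>
    rw [pow_zero, Module.End.one_apply, eventInd_of (by simp)]
    norm_num
  | succ n =>
    rw [pow_succ, Module.End.mul_apply]
    refine le_transfer_pow nbKernel (I := FreeGroup.IsReduced) isReduced_step (fun w hw => ?_) n []
      (by simp [FreeGroup.IsReduced])
    obtain ⟨s, hs, hcyc⟩ : ∃ s ∈ allowedNext w, FreeGroup.IsCyclicallyReduced (w ++ [s]) := by
      rcases w with _ | ⟨h, w⟩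
      · exact ⟨(0, true), mem_allowedNext.2 (by simp), by simp⟩
      · obtain ⟨t, ht⟩ : ∃ t, (h :: w).getLast? = some t :=
          ⟨_, List.getLast?_eq_some_getLast (by simp)⟩
        have key : ∀ h t : Letter, ∃ s : Letter, s ≠ (t.1, !t.2) ∧ (s.1 = h.1 → s.2 = h.2) := by
          decide
        obtain ⟨s, h1, h2⟩ := key h t
        have h3 : s ∈ allowedNext (h :: w) := mem_allowedNext.2 fun t' ht' => by
          rw [ht, Option.mem_def, Option.some.injEq] at ht'
          exact ht' ▸ h1
        exact ⟨s, h3, FreeGroup.isCyclicallyReduced_cons_append_iff.2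
          ⟨isReduced_append_singleton.2 ⟨hw, h3⟩, h2⟩⟩
    rw [transfer_apply]
    refine le_trans ?_ (Finset.single_le_sum (f := fun s => (nbKernel w s).toReal *
      eventInd FreeGroup.IsCyclicallyReduced (w ++ [s]))
      (fun t _ => mul_nonneg ENNReal.toReal_nonneg (eventInd_nonneg _ _)) (Finset.mem_univ s))
    rw [eventInd_of hcyc, mul_one]
    exact le_nbKernel_toReal hs

theorem cyclicallyReducedLaw_support {n : ℕ} {w : Word}
    (hw : w ∈ (cyclicallyReducedLaw n).support) : w ∈ cyclicallyReducedWords n := by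
  rw [cyclicallyReducedLaw, PMF.support_uniformOfFinset] at hw
  simpa using hw

/-- Every reduced word has the same probability c, and the cyclically reduced ones have total mass
|s| c ≥ 1/4. So 1/|s| ≤ 4c, which compares the laws pointwise. -/
theorem cyclicallyReducedLaw_prob_le (n : ℕ) (E : Word → Prop) :
    (cyclicallyReducedLaw n).prob E ≤ 4 * (markovLaw nbKernel n).prob E := by
  obtain ⟨c, hc⟩ := markovLaw_nbKernel_eq n
  set s := (cyclicallyReducedWords_finite n).toFinset with hs
  have hmem : ∀ w, w ∈ s ↔ w.length = n ∧ FreeGroup.IsCyclicallyReduced w := fun w => by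
    rw [hs, Set.Finite.mem_toFinset]; rfl
  have hcs : ∀ w ∈ s, markovLaw nbKernel n w = c := fun w hw =>
    hc w ((hmem w).1 hw).1 ((hmem w).1 hw).2.1
  have h1 : 1 / 4 ≤ s.card * c := by
    have h2 : (markovLaw nbKernel n).prob FreeGroup.IsCyclicallyReduced ≤
        (markovLaw nbKernel n).prob (· ∈ s) := PMF.prob_mono _ fun w hw hcyc =>
      (hmem w).2 ⟨(markovLaw_support nbKernel (I := FreeGroup.IsReduced)
        (by simp [FreeGroup.IsReduced]) isReduced_step n hw).1, hcyc⟩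
    have h3 := (quarter_le_prob_isCyclicallyReduced n).trans h2
    rw [PMF.prob, show {a | a ∈ s} = (s : Set Word) from rfl, PMF.toOuterMeasure_apply_finset,
      Finset.sum_congr rfl hcs, Finset.sum_const, nsmul_eq_mul] at h3
    have h4 := ENNReal.ofReal_le_ofReal h3
    have h5 := ENNReal.ofReal_toReal_le.trans' h4
    refine le_trans (le_of_eq ?_) h5
    rw [one_div, one_div, ENNReal.ofReal_inv_of_pos (by norm_num)]
    norm_num
  have hpt : ∀ w, cyclicallyReducedLaw n w ≤ 4 * markovLaw nbKernel n w := fun w => by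
    rw [cyclicallyReducedLaw, PMF.uniformOfFinset_apply]
    split_ifs with hw
    · rw [hcs w hw]
      have h0 : (s.card : ENNReal) ≠ 0 := by
        exact_mod_cast (Finset.card_pos.2 ⟨w, hw⟩).ne'
      rw [← hs, ENNReal.inv_le_iff_le_mul (fun _ => h0) (fun h => absurd h (by simp))]
      calc (1 : ENNReal) = 4 * (1 / 4) := by
            rw [one_div, ENNReal.mul_inv_cancel (by norm_num) (by norm_num)]
        _ ≤ 4 * (s.card * c) := mul_le_mul_right h1 4
        _ = _ := by ring
    · exact zero_le
  unfold PMF.prob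
  have h4 : (4 : ℝ) = (4 : ENNReal).toReal := by norm_num
  rw [h4, ← ENNReal.toReal_mul]
  refine ENNReal.toReal_mono (ENNReal.mul_ne_top (by norm_num) (PMF.toOuterMeasure_ne_top _ _)) ?_
  rw [PMF.toOuterMeasure_apply, PMF.toOuterMeasure_apply, ← ENNReal.tsum_mul_left]
  refine ENNReal.tsum_le_tsum fun w => ?_
  by_cases hw : E w
  · simpa [Set.indicator, hw] using hpt w
  · simp [Set.indicator, hw]

theorem cyclicallyReducedLaw_expRare_not_richTrace :
    ∃ κ : ℝ, 0 < κ ∧ ExpRare cyclicallyReducedLaw fun n w =>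
      ¬ RichTrace (tracePoly w.toGroup) ⌊κ * n⌋₊ n := by
  obtain ⟨κ, hκ, h⟩ := RandomModel.freelyReduced.expRare_not_richTrace
  rw [RandomModel.law, funext nonbacktrackingLaw_eq] at h
  exact ⟨κ, hκ, h.of_prob_le (by norm_num) fun n => cyclicallyReducedLaw_prob_le n _⟩

end Cyclic

/-! ### Output length and running time. -/

namespace SparseLayout

variable (S : SparseLayout)

theorem bitLength_le_length_term (m : Fin 3 →₀ ℕ) (c : ℤ) :
    bitLength c ≤ (S.term m c).length := by
  have h : ∀ l : List Bool, l.length ≤ (l.flatMap S.digit).length := fun l => by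
    induction l with
    | nil => simp
    | cons d l ih =>
      have := List.length_pos_iff.2 (S.digit_ne_nil d)
      simp only [List.flatMap_cons, List.length_append, List.length_cons]
      omega
  have h1 := h c.natAbs.bits.reverse
  rw [List.length_reverse, Nat.size_eq_bits_len] at h1
  simp only [term, List.length_append, bitLength]
  omega

theorem sum_length_le_length_intercalate {α : Type} (sep : List α) (l : List (List α)) :
    (l.map List.length).sum ≤ (sep.intercalate l).length := by
  induction l with
  | nil => simp
  | cons x l ih =>
    cases l with
    | nil => simp [List.intercalate]
    | cons y l =>
      rw [List.intercalate_cons_cons]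
      simp only [List.map_cons, List.sum_cons, List.length_append] at ih ⊢
      omega

theorem bitNorm_le_length {f : MvPolynomial (Fin 3) ℤ} {u : List S.Sym} (h : S.Represents f u) :
    bitNorm f ≤ u.length := by
  obtain ⟨ms, hnd, hms, rfl⟩ := h
  refine le_trans ?_ (sum_length_le_length_intercalate _ _)
  have e : f.support = ms.toFinset := by ext m; simp [hms]
  rw [bitNorm, e, List.sum_toFinset _ hnd, List.map_map]
  exact List.sum_le_sum fun m _ => S.bitLength_le_length_term m _

end SparseLayout

namespace TuringMachine

variable {Sym : Type} (M : TuringMachine Sym)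

/-- After `t` steps at most `t` cells of the output tape differ from their initial content. -/
theorem exists_changed_cells (w : Word) (t : ℕ) (c : M.Config) (h : M.run w t = some c) :
    ∃ s : Finset ℤ, s.card ≤ t ∧
      ∀ z ∉ s, c.tape M.outTape z = (M.init w).tape M.outTape z := by
  induction t generalizing c with
  | zero =>
    rw [run, Option.some.injEq] at h
    exact ⟨∅, by simp, fun z _ => by rw [h]⟩
  | succ t ih =>
    rw [run, Option.bind_eq_some_iff] at h
    obtain ⟨d, hd, hstep⟩ := h
    obtain ⟨s, hs, hz⟩ := ih d hd
    rw [step, Option.map_eq_some_iff] at hstep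
    obtain ⟨r, -, rfl⟩ := hstep
    refine ⟨insert (d.head M.outTape) s, (Finset.card_insert_le _ _).trans (by omega),
      fun z hzs => ?_⟩
    rw [Finset.mem_insert, not_or] at hzs
    simp only [Function.update_of_ne hzs.1]
    exact hz z hzs.2

theorem run_isSome_of_le (w : Word) {s t : ℕ} (h : s ≤ t) (ht : (M.run w t).isSome) :
    (M.run w s).isSome := by
  induction h with
  | refl => exact ht
  | step _ ih =>
    refine ih ?_
    rw [run] at ht
    exact Option.isSome_of_isSome_bind ht

theorem haltsAt_unique {w : Word} {s t : ℕ} {c d : M.Config} (hs : M.HaltsAt w s c)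
    (ht : M.HaltsAt w t d) : s = t := by
  have key : ∀ {s t : ℕ} {c d : M.Config}, M.HaltsAt w s c → M.HaltsAt w t d → t ≤ s := by
    intro s t c d hs ht
    by_contra hlt
    have := M.run_isSome_of_le w (Nat.succ_le_of_lt (not_le.1 hlt)) (by rw [ht.1]; rfl)
    rw [Nat.succ_eq_add_one, run, hs.1, Option.bind_some, hs.2] at this
    simp at this
  exact le_antisymm (key ht hs) (key hs ht)

theorem time_eq {w : Word} {t : ℕ} {c : M.Config} (h : M.HaltsAt w t c) : M.time w = t := by
  have : {t | ∃ c, M.HaltsAt w t c} = {t} := by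
    ext s
    exact ⟨fun ⟨d, hd⟩ => M.haltsAt_unique hd h, fun hs => ⟨c, hs ▸ h⟩⟩
  rw [time, this, csInf_singleton]

/-- A machine needs a step for each output symbol beyond the length of the input. -/
theorem length_le_time_add {w : Word} {u : List Sym} (h : M.Outputs w u) :
    u.length ≤ M.time w + w.length := by
  obtain ⟨t, c, hc, hu, -⟩ := h
  rw [M.time_eq hc]
  obtain ⟨s, hs, hz⟩ := M.exists_changed_cells w t c hc.1
  -- These cells are blank at the start even if the output tape is the input tape, and hold nonblank
  -- symbols at the end.
  have hsub : (Finset.Ico w.length u.length).image (Nat.cast : ℕ → ℤ) ⊆ s := by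
    intro z hzm
    rw [Finset.mem_image] at hzm
    obtain ⟨i, hi, rfl⟩ := hzm
    rw [Finset.mem_Ico] at hi
    by_contra hns
    have h1 := hz _ hns
    have h2 := hu ⟨i, hi.2⟩
    rw [h1] at h2
    refine M.outSymb_ne_blank _ (h2.symm.trans ?_)
    simp [init, List.getElem?_eq_none hi.1]
  have := Finset.card_le_card hsub
  rw [Finset.card_image_of_injective _ Nat.cast_injective, Nat.card_Ico] at this
  omega

end TuringMachine

theorem bitNorm_le_time_add {S : SparseConvention} {M : TuringMachine S.Sym} {I : Set Word}
    (h : ComputesTracePoly S M I) {w : Word} (hw : w ∈ I) :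
    bitNorm (tracePoly w.toGroup) ≤ M.time w + w.length := by
  obtain ⟨u, hu, hrep⟩ := h w hw
  exact (S.toSparseLayout.bitNorm_le_length hrep).trans (M.length_le_time_add hu)

/-! ### From rich traces to the asymptotic bounds. -/

theorem le_floor_of_two_le {x : ℝ} (hx : 1 ≤ x) : x / 2 ≤ ⌊x⌋₊ := by
  have h1 := Nat.lt_floor_add_one x
  have h2 : (1 : ℝ) ≤ ⌊x⌋₊ := by exact_mod_cast (Nat.one_le_floor_iff x).2 hx
  linarith

section Consequences

variable {μ : ℕ → PMF Word} {κ : ℝ}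

theorem le_mul_of_ceil_le {a κ : ℝ} (hκ : 0 < κ) {n : ℕ} (hn : n ≥ ⌈a / κ⌉₊) : a ≤ κ * n := by
  have := (Nat.le_ceil (a / κ)).trans (Nat.cast_le.2 hn)
  rwa [div_le_iff₀ hκ, mul_comm] at this

theorem expRare_support (hκ : 0 < κ)
    (h : ExpRare μ fun n w => ¬ RichTrace (tracePoly w.toGroup) ⌊κ * n⌋₊ n) :
    ExpRare μ fun n w =>
      ¬ (κ / 2) ^ 2 * (n : ℝ) ^ 2 ≤ ((tracePoly w.toGroup).support.card : ℝ) := by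
  refine h.mono ⌈1 / κ⌉₊ fun n hn w _ hlt hrich => hlt ?_
  have h2 := le_floor_of_two_le (le_mul_of_ceil_le hκ hn)
  calc (κ / 2) ^ 2 * (n : ℝ) ^ 2 = (κ * n / 2) ^ 2 := by ring
    _ ≤ (⌊κ * n⌋₊ : ℝ) ^ 2 := pow_le_pow_left₀ (by positivity) h2 2
    _ ≤ _ := by exact_mod_cast hrich.sq_le_card_support

theorem expRare_coeff (hκ : 0 < κ)
    (h : ExpRare μ fun n w => ¬ RichTrace (tracePoly w.toGroup) ⌊κ * n⌋₊ n) :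
    ExpRare μ fun n w => ¬ ∃ m : Fin 3 →₀ ℕ,
      (κ / 4) ^ 3 / 6 * (n : ℝ) ^ 3 ≤ |(((tracePoly w.toGroup).coeff m : ℤ) : ℝ)| ∧
        |(((tracePoly w.toGroup).coeff m : ℤ) : ℝ)| ≤ 1 * (n : ℝ) ^ 3 := by
  refine h.mono ⌈8 / κ⌉₊ fun n hn w _ hlt hrich => hlt ?_
  have h1 := le_mul_of_ceil_le hκ hn
  have h2 := le_floor_of_two_le (x := κ * n) (by linarith)
  set K := ⌊κ * n⌋₊ with hK
  have h3 : 4 ≤ K := by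
    have : (4 : ℝ) ≤ K := by linarith
    exact_mod_cast this
  obtain ⟨m, hm1, hm2⟩ := hrich.exists_coeff (by omega)
  refine ⟨m, ?_, ?_⟩
  · rw [← Int.cast_abs, Int.abs_eq_natAbs, Int.cast_natCast]
    -- Since K ≥ 4, one has K - 2 ≥ K/2, and K ≥ κn/2. The binomial is then bounded below by (K -
    -- 2)³/3!.
    have h4 : κ * n / 4 ≤ ((K + 1 - 3 : ℕ) : ℝ) := by
      rw [Nat.cast_sub (by omega)]
      have : (4 : ℝ) ≤ K := by exact_mod_cast h3
      push_cast
      linarith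
    have h5 := Nat.pow_le_choose (α := ℝ) 3 K
    have h6 : ((Nat.factorial 3 : ℕ) : ℝ) = 6 := by norm_num [Nat.factorial]
    rw [h6] at h5
    calc (κ / 4) ^ 3 / 6 * (n : ℝ) ^ 3 = (κ * n / 4) ^ 3 / 6 := by ring
      _ ≤ ((K + 1 - 3 : ℕ) : ℝ) ^ 3 / 6 := by gcongr
      _ ≤ (K.choose 3 : ℝ) := h5
      _ ≤ _ := by exact_mod_cast hm1
  · rw [← Int.cast_abs, Int.abs_eq_natAbs, Int.cast_natCast, one_mul]
    exact_mod_cast hm2.trans (Nat.choose_le_pow n 3)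

theorem expRare_bitNorm (hκ : 0 < κ)
    (h : ExpRare μ fun n w => ¬ RichTrace (tracePoly w.toGroup) ⌊κ * n⌋₊ n) :
    ExpRare μ fun n w =>
      ¬ (κ / 16) ^ 3 * (n : ℝ) ^ 3 ≤ (bitNorm (tracePoly w.toGroup) : ℝ) := by
  refine h.mono ⌈8 / κ⌉₊ fun n hn w _ hlt hrich => hlt ?_
  have h1 := le_mul_of_ceil_le hκ hn
  have h2 := le_floor_of_two_le (x := κ * n) (by linarith)
  have h3 := le_floor_of_two_le (x := κ * n / 4) (by linarith)
  -- The side length is M = ⌊κn/4⌋ ≥ κn/8, which leaves room for the constant κ/16.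
  have h4 : 4 * ⌊κ * n / 4⌋₊ ≤ ⌊κ * n⌋₊ := by
    refine Nat.le_floor ?_
    push_cast
    linarith [Nat.floor_le (show 0 ≤ κ * n / 4 by positivity)]
  calc (κ / 16) ^ 3 * (n : ℝ) ^ 3 = (κ * n / 16) ^ 3 := by ring
    _ ≤ (⌊κ * n / 4⌋₊ : ℝ) ^ 3 := pow_le_pow_left₀ (by positivity) (by linarith) 3
    _ ≤ _ := by exact_mod_cast hrich.cube_le_bitNorm h4

/-- A lower bound for the bit norm of the trace polynomial bounds the running time of all machines
which output it. -/
theorem exists_time_bound {I : ℕ → Set Word} (hI : ∀ n, ∀ w ∈ I n, w.length = n)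
    (hμ : ∀ n, ∀ w ∈ (μ n).support, w ∈ I n) {c : ℝ} (hc : 0 < c)
    (h : ExpRare μ fun n w => ¬ c * (n : ℝ) ^ 3 ≤ (bitNorm (tracePoly w.toGroup) : ℝ))
    (S : SparseConvention) :
    ∃ c C lam : ℝ, 0 < c ∧ 0 < C ∧ 0 < lam ∧
      ∀ (M : TuringMachine S.Sym) (n : ℕ), 1 ≤ n → ComputesTracePoly S M (I n) →
        1 - C * Real.exp (-lam * n) ≤
          (μ n).prob fun w => c * (n : ℝ) ^ 3 ≤ (M.time w : ℝ) := by
  -- Half of the cubic bound absorbs the n input cells: if cn ≥ 2, then (c/2) n³ ≥ n² ≥ n. The event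
  -- does not mention the machine, so the constants are uniform over machines.
  have h' : ExpRare μ fun n w => ¬ (c / 2 * (n : ℝ) ^ 3 + n ≤ bitNorm (tracePoly w.toGroup)) := by
    refine h.mono (max 1 ⌈2 / c⌉₊) fun n hn w _ hlt hle => hlt (le_trans ?_ hle)
    have h1 : 2 ≤ c * n := le_mul_of_ceil_le hc ((le_max_right _ _).trans hn)
    have h2 : (1 : ℝ) ≤ n := by exact_mod_cast (le_max_left _ _).trans hn
    have h3 : (n : ℝ) ≤ n ^ 2 := by nlinarith
    nlinarith [mul_le_mul_of_nonneg_right h1 (sq_nonneg (n : ℝ))]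
  obtain ⟨C, lam, hC, hl, hp⟩ := h'.likely
  refine ⟨c / 2, C, lam, by positivity, hC, hl, fun M n _ hM => (hp n).trans ?_⟩
  refine PMF.prob_mono _ fun w hw hle => ?_
  have h1 : (bitNorm (tracePoly w.toGroup) : ℝ) ≤ M.time w + w.length := by
    exact_mod_cast bitNorm_le_time_add hM (hμ n w hw)
  rw [hI n w (hμ n w hw)] at h1
  linarith

end Consequences

theorem theorem1p8 :
    (∀ 𝓜 : RandomModel,
      (∃ c C lam : ℝ, 0 < c ∧ 0 < C ∧ 0 < lam ∧ ∀ n : ℕ, 1 ≤ n →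
        1 - C * Real.exp (-lam * n) ≤
          (𝓜.law n).prob fun w => c * (n : ℝ) ^ 2 ≤ ((tracePoly w.toGroup).support.card : ℝ)) ∧
      (∃ c₁ c₂ C lam : ℝ, 0 < c₁ ∧ 0 < c₂ ∧ 0 < C ∧ 0 < lam ∧ ∀ n : ℕ, 1 ≤ n →
        1 - C * Real.exp (-lam * n) ≤
          (𝓜.law n).prob fun w => ∃ m : Fin 3 →₀ ℕ,
            c₁ * (n : ℝ) ^ 3 ≤ |(((tracePoly w.toGroup).coeff m : ℤ) : ℝ)| ∧
            |(((tracePoly w.toGroup).coeff m : ℤ) : ℝ)| ≤ c₂ * (n : ℝ) ^ 3) ∧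
      (∃ c C lam : ℝ, 0 < c ∧ 0 < C ∧ 0 < lam ∧ ∀ n : ℕ, 1 ≤ n →
        1 - C * Real.exp (-lam * n) ≤
          (𝓜.law n).prob fun w => c * (n : ℝ) ^ 3 ≤ (bitNorm (tracePoly w.toGroup) : ℝ)) ∧
      (∀ S : SparseConvention, ∃ c C lam : ℝ, 0 < c ∧ 0 < C ∧ 0 < lam ∧
        ∀ (M : TuringMachine S.Sym) (n : ℕ), 1 ≤ n → ComputesTracePoly S M (𝓜.words n) →
          1 - C * Real.exp (-lam * n) ≤
            (𝓜.law n).prob fun w => c * (n : ℝ) ^ 3 ≤ (M.time w : ℝ))) ∧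
    (∀ S : SparseConvention, ∃ c C lam : ℝ, 0 < c ∧ 0 < C ∧ 0 < lam ∧
      ∀ (M : TuringMachine S.Sym) (n : ℕ), 1 ≤ n →
        ComputesTracePoly S M (cyclicallyReducedWords n) →
          1 - C * Real.exp (-lam * n) ≤
            (cyclicallyReducedLaw n).prob fun w => c * (n : ℝ) ^ 3 ≤ (M.time w : ℝ)) := by
  refine ⟨fun 𝓜 => ?_, ?_⟩
  · obtain ⟨κ, hκ, h⟩ := 𝓜.expRare_not_richTrace
    refine ⟨?_, ?_, ?_, ?_⟩
    · obtain ⟨C, lam, hC, hl, hp⟩ := (expRare_support hκ h).likely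
      exact ⟨_, C, lam, by positivity, hC, hl, fun n _ => hp n⟩
    · obtain ⟨C, lam, hC, hl, hp⟩ := (expRare_coeff hκ h).likely
      exact ⟨_, _, C, lam, by positivity, one_pos, hC, hl, fun n _ => hp n⟩
    · obtain ⟨C, lam, hC, hl, hp⟩ := (expRare_bitNorm hκ h).likely
      exact ⟨_, C, lam, by positivity, hC, hl, fun n _ => hp n⟩
    · exact exists_time_bound (fun n w hw => (𝓜.words_reduced n hw).1)
        (fun n w hw => 𝓜.law_support n hw) (by positivity) (expRare_bitNorm hκ h)
  · obtain ⟨κ, hκ, h⟩ := cyclicallyReducedLaw_expRare_not_richTrace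
    exact exists_time_bound (fun n w hw => hw.1) (fun n w hw => cyclicallyReducedLaw_support hw)
      (by positivity) (expRare_bitNorm hκ h)
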